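/- For a prime $q$ and an integer $a$ put $$S(q,a)=\sum_{\chi \bmod q}^{*}|L(1/2,\chi)|^2\,\chi(a),$$ where the sum runs over all primitive Dirichlet characters $\chi$ modulo $q$ and $L(s,\chi)$ denotes the (analytically continued) Dirichlet $L$-function of $\chi$. Let $A=\gamma-\log(8\pi)$, where $\gamma$ is Euler's constant, and $B=2\zeta(1/2)^2$. Then, for primes $p$ and $h$ with $h<p$, $$S(p,h)=\sqrt{\frac{p}{h}}\;S(h,-p)+\frac{p}{\sqrt h}\left(\log\frac{p}{h}+A\right)+\frac{B}{2}\sqrt p+O\!\left(h+\log p+\sqrt{\frac{p}{h}}\,\log p\right),$$ uniformly for $h<p$; that is, the implied constant is absolute: it depends on neither $p$ nor $h$. -/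

import Mathlib

open Classical in
/-- The twisted second moment `S(q, a) = ∑* |L(1/2, χ)|² χ(a)`, the sum being over all primitive
Dirichlet characters `χ` modulo `q`; here `a` is any integer. `DirichletCharacter.LFunction` is the
analytic continuation of the Dirichlet `L`-series of `χ`. -/
noncomputable def twistedMoment (q : ℕ) [NeZero q] (a : ℤ) : ℂ :=
  ∑ χ : DirichletCharacter ℂ q with χ.IsPrimitive,
    ((‖DirichletCharacter.LFunction χ (1 / 2)‖ ^ 2 : ℝ) : ℂ) * χ (a : ZMod q)

/-- The constant `A = γ - log (8π)`, with `γ` Euler's constant. -/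
noncomputable def constA : ℝ := Real.eulerMascheroniConstant - Real.log (8 * Real.pi)

/-- The constant `B = 2 ζ(1/2)²`. -/
noncomputable def constB : ℂ := 2 * riemannZeta (1 / 2) ^ 2

/-!
Write `F(x) = ζ(1/2, x)`. Since `L(1/2, χ) = q^{-1/2} ∑_b χ(b) F(b/q)`, orthogonality of characters
turns `S(q, a)` for prime `q`, up to `O(1 + log q)`, into the Dedekind-type sum
`W(q, a) = ∑_{b mod q} F({b/q}) F({ab/q})` (`norm_twistedMoment_sub_le`). It remains to prove a
reciprocity law for `W` with error `O(h)`, `abs_hurwitzHalfSum_sub_le`.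

In `W(p, h)` group the `b` with `jp < hb ≤ (j+1)p`, for `0 ≤ j < h`. On such a block `hb/p - j = t`
runs through a progression of step `h/p` in `(0, 1]` with offset `ρ_j h/p`, where
`ρ_j = {-jp/h}`, and the summand is `F((j+t)/h) F(t)`. For `j > 0` the only singularity is the one of
`F(t) = t^{-1/2} + F(1+t)` at `0`. Sampling `t^{-1/2}` along the progression gives the integral
plus `√(p/h) F(ρ_j)` plus `O(1)`, so the block equals
`(p/h) ∫₀¹ F((j+t)/h) F(t) dt + √(p/h) F(j/h) F(ρ_j) + O(√(h/j))`. The secondary terms sum to the dual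
sum `√(p/h) W(h, -p)`. For `j = 0` the product behaves like `√h / t`, which gives
`(p/√h)(log(p/h) + γ)` and `ζ(1/2)² √p`. All error terms are controlled by monotonicity and convexity
of `F` alone: sums of bounded monotone functions differ from their integrals by `O(1)`.

Since `∑_j F((j+t)/h) = √h F(t)`, the integrals add up to `(p/√h) ∫₀¹ (F(t)² - 1/t) dt`, and this
integral is `-log (8π)` (`integral_hurwitzHalf_sq_sub`). For the truncation of `F` to `N` terms the
antiderivatives `2 log(√(t+m) + √(t+n))` telescope along diagonals when summed over `m, n < N`; what
is left is evaluated by Stirling's formula and the trapezoidal rule for `log(1 + √x)`.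
-/

section

open Filter Topology Set intervalIntegral
open MeasureTheory (volume)

/-! ### The Hurwitz zeta function at `1/2` on the positive real axis -/

/-- The `n`-th term `1 / √(x + n) - ∫_{x+n}^{x+n+1} du / √u` of the convergent series behind
`ζ(1/2, x)`. -/
noncomputable def hurwitzHalfTerm (x : ℝ) (n : ℕ) : ℝ :=
  1 / √(x + n) - 2 * (√(x + n + 1) - √(x + n))

/-- The Hurwitz zeta value `ζ(1/2, x)` for real `x > 0`, as the Euler–Maclaurin regularisation
of `∑ (x + n)^{-1/2}`: the subtracted integrals telescope to `2 √(x + N) - 2 √x`, so this is the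
limit of `∑_{n < N} 1 / √(x + n) - 2 √(x + N)` (see `tendsto_hurwitzHalf`). -/
noncomputable def hurwitzHalf (x : ℝ) : ℝ :=
  ∑' n, hurwitzHalfTerm x n - 2 * √x

lemma two_mul_sqrt_succ_sub_le {a : ℝ} (ha : 0 < a) : 2 * (√(a + 1) - √a) ≤ 1 / √a := by
  have h1 : 0 < √a := Real.sqrt_pos.2 ha
  have h2 : √a ^ 2 = a := Real.sq_sqrt ha.le
  have h3 : √(a + 1) ^ 2 = a + 1 := Real.sq_sqrt (by linarith)
  rw [le_div_iff₀ h1]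
  nlinarith [sq_nonneg (√(a + 1) - √a)]

lemma le_two_mul_sqrt_succ_sub {a : ℝ} (ha : 0 ≤ a) : 1 / √(a + 1) ≤ 2 * (√(a + 1) - √a) := by
  have h1 : 0 < √(a + 1) := Real.sqrt_pos.2 (by linarith)
  have h2 : √a ^ 2 = a := Real.sq_sqrt ha
  have h3 : √(a + 1) ^ 2 = a + 1 := Real.sq_sqrt (by linarith)
  rw [div_le_iff₀ h1]
  nlinarith [sq_nonneg (√(a + 1) - √a)]

lemma hurwitzHalfTerm_nonneg {x : ℝ} (hx : 0 < x) (n : ℕ) : 0 ≤ hurwitzHalfTerm x n := by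
  have := two_mul_sqrt_succ_sub_le (a := x + n) (by positivity)
  unfold hurwitzHalfTerm; linarith

lemma sum_range_hurwitzHalfTerm_le {x : ℝ} (hx : 0 < x) (N : ℕ) :
    ∑ n ∈ Finset.range N, hurwitzHalfTerm x n ≤ 1 / √x := by
  have key : ∀ N : ℕ, ∑ n ∈ Finset.range N, hurwitzHalfTerm x n ≤ 1 / √x - 1 / √(x + N) := by
    intro N
    induction N with
    | zero => simp
    | succ N ih =>
      have := le_two_mul_sqrt_succ_sub (a := x + N) (by positivity)
      rw [Finset.sum_range_succ, hurwitzHalfTerm]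
      push_cast
      rw [← add_assoc]
      linarith
  have : 0 ≤ 1 / √(x + N) := by positivity
  linarith [key N]

lemma summable_hurwitzHalfTerm {x : ℝ} (hx : 0 < x) : Summable (hurwitzHalfTerm x) :=
  summable_of_sum_range_le (hurwitzHalfTerm_nonneg hx) (sum_range_hurwitzHalfTerm_le hx)

lemma neg_two_mul_sqrt_le_hurwitzHalf {x : ℝ} (hx : 0 < x) : -(2 * √x) ≤ hurwitzHalf x := by
  have : 0 ≤ ∑' n, hurwitzHalfTerm x n := tsum_nonneg (hurwitzHalfTerm_nonneg hx)
  unfold hurwitzHalf; linarith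

lemma hurwitzHalf_le {x : ℝ} (hx : 0 < x) : hurwitzHalf x ≤ 1 / √x - 2 * √x := by
  have := Real.tsum_le_of_sum_range_le (hurwitzHalfTerm_nonneg hx) (sum_range_hurwitzHalfTerm_le hx)
  unfold hurwitzHalf; linarith

lemma hurwitzHalf_eq_add {x : ℝ} (hx : 0 < x) : hurwitzHalf x = 1 / √x + hurwitzHalf (x + 1) := by
  unfold hurwitzHalf
  rw [(summable_hurwitzHalfTerm hx).tsum_eq_zero_add]
  have : (fun n : ℕ => hurwitzHalfTerm x (n + 1)) = hurwitzHalfTerm (x + 1) := by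
    ext n; unfold hurwitzHalfTerm; push_cast
    rw [show x + (n + 1 : ℝ) = x + 1 + n by ring]
  have h0 : hurwitzHalfTerm x 0 = 1 / √x - 2 * (√(x + 1) - √x) := by simp [hurwitzHalfTerm]
  rw [this, h0]
  ring

lemma hurwitzHalf_eq_sum_add {x : ℝ} (hx : 0 < x) (N : ℕ) :
    hurwitzHalf x = ∑ n ∈ Finset.range N, 1 / √(x + n) + hurwitzHalf (x + N) := by
  induction N with
  | zero => simp
  | succ N ih =>
    rw [Finset.sum_range_succ, ih, hurwitzHalf_eq_add (x := x + N) (by positivity)]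
    push_cast; rw [add_assoc x]; ring

/-- The partial sums of `∑ 1 / √(x + n)`, corrected by `2 √(x + N)`, approximate `ζ(1/2, x)`
with error at most `1 / √(x + N)`, uniformly in `x`. -/
lemma abs_sum_sub_sub_hurwitzHalf_le {x : ℝ} (hx : 0 < x) (N : ℕ) :
    |∑ n ∈ Finset.range N, 1 / √(x + n) - 2 * √(x + N) - hurwitzHalf x| ≤ 1 / √(x + N) := by
  have hN : 0 < x + N := by positivity
  have h1 := neg_two_mul_sqrt_le_hurwitzHalf hN
  have h2 := hurwitzHalf_le hN
  have h3 := hurwitzHalf_eq_sum_add hx N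
  rw [abs_le]; constructor <;> linarith [show 0 ≤ 1 / √(x + N) by positivity]

lemma tendsto_one_div_sqrt_add_nat (x : ℝ) :
    Tendsto (fun N : ℕ => 1 / √(x + N)) atTop (𝓝 0) := by
  simp only [one_div]
  refine tendsto_inv_atTop_zero.comp (Real.tendsto_sqrt_atTop.comp ?_)
  exact tendsto_atTop_add_const_left _ _ tendsto_natCast_atTop_atTop

lemma tendsto_sqrt_add_nat_sub {x y : ℝ} (hx : 0 < x) (hxy : x ≤ y) :
    Tendsto (fun N : ℕ => √(y + N) - √(x + N)) atTop (𝓝 0) := by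
  have hlim := (tendsto_one_div_sqrt_add_nat x).const_mul (y - x)
  rw [mul_zero] at hlim
  refine squeeze_zero (fun N => ?_) (fun N => ?_) hlim
  · have : √(x + N) ≤ √(y + N) := by gcongr
    linarith
  · have hpos : 0 < x + N := by positivity
    have ha : 0 < √(x + N) := Real.sqrt_pos.2 hpos
    have hb : √(x + N) ≤ √(y + N) := by gcongr
    have ha2 : √(x + N) ^ 2 = x + N := Real.sq_sqrt hpos.le
    have hb2 : √(y + N) ^ 2 = y + N := Real.sq_sqrt (by linarith)
    rw [mul_one_div, le_div_iff₀ ha]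
    nlinarith

lemma tendsto_hurwitzHalf {x : ℝ} (hx : 0 < x) :
    Tendsto (fun N : ℕ => ∑ n ∈ Finset.range N, 1 / √(x + n) - 2 * √(x + N)) atTop
      (𝓝 (hurwitzHalf x)) := by
  rw [tendsto_iff_dist_tendsto_zero]
  exact squeeze_zero (fun _ => dist_nonneg) (fun N => abs_sum_sub_sub_hurwitzHalf_le hx N)
    (tendsto_one_div_sqrt_add_nat x)

lemma abs_hurwitzHalf_le {x : ℝ} (hx : 0 < x) (hx1 : x ≤ 1) : |hurwitzHalf x| ≤ 2 / √x := by
  have h1 := neg_two_mul_sqrt_le_hurwitzHalf hx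
  have h2 := hurwitzHalf_le hx
  have h0 : 0 < √x := Real.sqrt_pos.2 hx
  have h3 : √x ≤ 1 := Real.sqrt_le_one.2 hx1
  have h4 : 1 ≤ 1 / √x := by rw [le_div_iff₀ h0]; linarith
  rw [abs_le]; constructor
  · rw [show 2 / √x = 2 * (1 / √x) by ring]; linarith
  · rw [show 2 / √x = 2 * (1 / √x) by ring]; linarith

lemma abs_hurwitzHalf_le_three {x : ℝ} (hx : 1 ≤ x) (hx2 : x ≤ 2) : |hurwitzHalf x| ≤ 3 := by
  have h1 := neg_two_mul_sqrt_le_hurwitzHalf (x := x) (by linarith)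
  have h2 := hurwitzHalf_le (x := x) (by linarith)
  have h3 : √x ≤ 3 / 2 := by
    rw [Real.sqrt_le_left (by norm_num)]; linarith
  have h0 : 1 ≤ √x := Real.one_le_sqrt.2 hx
  have h4 : 1 / √x ≤ 1 := by rw [div_le_iff₀ (by linarith)]; linarith
  rw [abs_le]; constructor <;> linarith

lemma antitoneOn_hurwitzHalf : AntitoneOn hurwitzHalf (Ioi 0) := by
  intro x hx y hy hxy
  rw [mem_Ioi] at hx hy
  refine le_of_tendsto_of_tendsto' (tendsto_hurwitzHalf hy) (tendsto_hurwitzHalf hx) fun N => ?_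
  have : ∑ n ∈ Finset.range N, 1 / √(y + n) ≤ ∑ n ∈ Finset.range N, 1 / √(x + n) := by
    gcongr
  have h2 : √(x + N) ≤ √(y + N) := by gcongr
  linarith

lemma convexOn_one_div_sqrt : ConvexOn ℝ (Ioi 0) (fun x : ℝ => 1 / √x) := by
  refine ⟨convex_Ioi 0, fun x hx y hy a b ha hb hab => ?_⟩
  have hx' : 0 < √x := Real.sqrt_pos.2 hx
  have hy' : 0 < √y := Real.sqrt_pos.2 hy
  have h1 := Real.strictConcaveOn_sqrt.concaveOn.2 (Ioi_subset_Ici_self hx)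
    (Ioi_subset_Ici_self hy) ha hb hab
  have h2 := (convexOn_zpow (𝕜 := ℝ) (-1)).2 (mem_Ioi.2 hx') (mem_Ioi.2 hy') ha hb hab
  have h3 : 0 < a • √x + b • √y := mem_Ioi.1 (convex_Ioi (0 : ℝ) hx' hy' ha hb hab)
  simp only [zpow_neg_one, one_div] at h2 ⊢
  exact (inv_anti₀ h3 h1).trans h2

lemma convexOn_hurwitzHalf : ConvexOn ℝ (Ioi 0) hurwitzHalf := by
  refine ⟨convex_Ioi 0, fun x hx y hy a b ha hb hab => ?_⟩
  have hz := (convex_Ioi (0 : ℝ)) hx hy ha hb hab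
  rw [mem_Ioi] at hx hy hz
  refine le_of_tendsto_of_tendsto' (tendsto_hurwitzHalf hz)
    (((tendsto_hurwitzHalf hx).const_smul a).add ((tendsto_hurwitzHalf hy).const_smul b))
    fun N => ?_
  have key : ∀ n : ℕ, a • x + b • y + n = a • (x + n) + b • (y + n) := by
    intro n; simp only [smul_eq_mul]; linear_combination -(n : ℝ) * hab
  have h1 : ∑ n ∈ Finset.range N, 1 / √(a • x + b • y + n) ≤
      ∑ n ∈ Finset.range N, (a • (1 / √(x + n)) + b • (1 / √(y + n))) := by
    refine Finset.sum_le_sum fun n _ => ?_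
    rw [key]
    exact convexOn_one_div_sqrt.2 (mem_Ioi.2 (by positivity)) (mem_Ioi.2 (by positivity)) ha hb hab
  have h2 : a • √(x + N) + b • √(y + N) ≤ √(a • x + b • y + N) := by
    rw [key]
    exact Real.strictConcaveOn_sqrt.concaveOn.2 (mem_Ici.2 (by positivity))
      (mem_Ici.2 (by positivity)) ha hb hab
  rw [Finset.sum_add_distrib, ← Finset.smul_sum, ← Finset.smul_sum] at h1
  simp only [smul_eq_mul] at *
  linarith

/-- A bound for the slopes of `ζ(1/2, ·)` to the right of `x`: by convexity they are dominated by
the slope between `x / 2` and `x`. -/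
lemma hurwitzHalf_sub_le {x y : ℝ} (hx : 0 < x) (hx1 : x ≤ 1) (hxy : x ≤ y) :
    hurwitzHalf x - hurwitzHalf y ≤ 10 / (x * √x) * (y - x) := by
  rcases hxy.eq_or_lt with rfl | hlt
  · simp
  have h := convexOn_hurwitzHalf.slope_mono_adjacent (x := x / 2) (y := x) (z := y)
    (mem_Ioi.2 (by linarith)) (mem_Ioi.2 (by linarith)) (by linarith) hlt
  have h1 := (abs_le.1 (abs_hurwitzHalf_le hx hx1)).1
  have h2 := (abs_le.1 (abs_hurwitzHalf_le (half_pos hx) (by linarith))).2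
  have h0 : 0 < √x := Real.sqrt_pos.2 hx
  have h3 : 2 / √(x / 2) ≤ 3 / √x := by
    rw [div_le_div_iff₀ (Real.sqrt_pos.2 (by linarith)) h0]
    have : √x = √2 * √(x / 2) := by
      rw [← Real.sqrt_mul (by norm_num)]; congr 1; ring
    have h2 : √2 ≤ 3 / 2 := by rw [Real.sqrt_le_left (by norm_num)]; norm_num
    rw [this]
    nlinarith [Real.sqrt_nonneg (x / 2)]
  have h4 : (hurwitzHalf (x / 2) - hurwitzHalf x) / (x / 2) ≤ 10 / (x * √x) := by
    rw [div_le_iff₀ (by linarith)]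
    have : 10 / (x * √x) * (x / 2) = 3 / √x + 2 / √x := by field_simp; norm_num
    rw [this]; linarith
  have h5 : (hurwitzHalf x - hurwitzHalf y) / (y - x) ≤ 10 / (x * √x) := by
    refine le_trans ?_ h4
    rw [show x - x / 2 = x / 2 by ring] at h
    have e1 : (hurwitzHalf x - hurwitzHalf y) / (y - x) =
      -((hurwitzHalf y - hurwitzHalf x) / (y - x)) := by ring
    have e2 : (hurwitzHalf (x / 2) - hurwitzHalf x) / (x / 2) =
      -((hurwitzHalf x - hurwitzHalf (x / 2)) / (x / 2)) := by ring
    rw [e1, e2]; linarith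
  rwa [div_le_iff₀ (by linarith)] at h5

/-- The distribution relation of the Hurwitz zeta function at `s = 1/2`. -/
lemma sum_hurwitzHalf_div {t : ℝ} (ht : 0 < t) {h : ℕ} (hh : 0 < h) :
    ∑ j ∈ Finset.range h, hurwitzHalf ((j + t) / h) = √h * hurwitzHalf t := by
  have hh' : (0 : ℝ) < h := by exact_mod_cast hh
  have h1 : Tendsto (fun N : ℕ => ∑ j ∈ Finset.range h,
      (∑ n ∈ Finset.range N, 1 / √((j + t) / h + n) - 2 * √((j + t) / h + N))) atTop
      (𝓝 (∑ j ∈ Finset.range h, hurwitzHalf ((j + t) / h))) :=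
    tendsto_finsetSum _ fun j _ => tendsto_hurwitzHalf (by positivity)
  have h2 : Tendsto (fun N : ℕ => √h * (∑ n ∈ Finset.range (h * N), 1 / √(t + n) -
      2 * √(t + (h * N : ℕ)))) atTop (𝓝 (√h * hurwitzHalf t)) :=
    ((tendsto_hurwitzHalf ht).comp (tendsto_id.const_mul_atTop' hh)).const_mul _
  have hblock : ∀ N : ℕ, ∑ j ∈ Finset.range h, ∑ n ∈ Finset.range N, 1 / √((j + t) / h + n) =
      √h * ∑ n ∈ Finset.range (h * N), 1 / √(t + n) := by
    intro N
    induction N with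
    | zero => simp
    | succ N ih =>
      simp only [Finset.sum_range_succ, Finset.sum_add_distrib]
      rw [ih, Nat.mul_succ, Finset.sum_range_add, mul_add, Finset.mul_sum (Finset.range h)]
      congr 1
      refine Finset.sum_congr rfl fun j _ => ?_
      have : ((j : ℝ) + t) / h + N = (t + ((h * N + j : ℕ) : ℝ)) / h := by
        push_cast; field_simp; ring
      rw [this, Real.sqrt_div (by positivity), one_div_div, mul_one_div]
  have h3 : Tendsto (fun N : ℕ => ∑ j ∈ Finset.range h,
      2 * (√((j + t) / h + N) - √(t / h + N))) atTop (𝓝 (∑ j ∈ Finset.range h, 0)) := by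
    refine tendsto_finsetSum _ fun j _ => ?_
    have := tendsto_sqrt_add_nat_sub (x := t / h) (y := (j + t) / h) (by positivity)
      (by gcongr; simp)
    simpa using this.const_mul 2
  refine tendsto_nhds_unique h1 ?_
  have h4 := h2.sub h3
  rw [Finset.sum_const_zero, sub_zero] at h4
  refine h4.congr fun N => ?_
  rw [Finset.sum_sub_distrib, hblock, mul_sub]
  have : √h * (2 * √(t + (h * N : ℕ))) = ∑ j ∈ Finset.range h, 2 * √(t / h + N) := by
    rw [Finset.sum_const, Finset.card_range, nsmul_eq_mul]
    have e : t / h + N = (t + (h * N : ℕ)) / h := by push_cast; field_simp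
    have hs : √(h : ℝ) * √h = h := Real.mul_self_sqrt hh'.le
    rw [e, Real.sqrt_div (by positivity)]
    have : 0 < √(h : ℝ) := Real.sqrt_pos.2 hh'
    field_simp
    rw [sq, hs]
  rw [this]
  simp only [mul_sub, Finset.sum_sub_distrib]
  ring

/-! ### Comparison with the analytic continuation -/

lemma norm_cpow_neg_sub_cpow_neg_le {x y : ℝ} (hx : 0 < x) (hxy : x ≤ y) {s : ℂ} (hs : 0 < s.re) :
    ‖(x : ℂ) ^ (-s) - (y : ℂ) ^ (-s)‖ ≤ ‖s‖ * x ^ (-s.re - 1) * (y - x) := by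
  have h := (convex_Icc x y).norm_image_sub_le_of_norm_hasDerivWithin_le
    (f := fun u : ℝ => (u : ℂ) ^ (-s)) (f' := fun u : ℝ => -s * (u : ℂ) ^ (-s - 1))
    (C := ‖s‖ * x ^ (-s.re - 1)) (x := y) (y := x) (fun u hu => ?_) (fun u hu => ?_)
    (right_mem_Icc.2 hxy) (left_mem_Icc.2 hxy)
  · rwa [Real.norm_eq_abs, abs_sub_comm, abs_of_nonneg (by linarith)] at h
  · have hu0 : 0 < u := hx.trans_le hu.1
    have := ((hasDerivAt_id (u : ℂ)).cpow_const (c := -s)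
      (Or.inl (by simpa using hu0))).comp_ofReal
    simpa using this.hasDerivWithinAt
  · have hu0 : 0 < u := hx.trans_le hu.1
    rw [norm_mul, norm_neg, Complex.norm_cpow_eq_rpow_re_of_pos hu0]
    refine mul_le_mul_of_nonneg_left ?_ (norm_nonneg s)
    simp only [Complex.sub_re, Complex.neg_re, Complex.one_re]
    exact Real.rpow_le_rpow_of_nonpos hx hu.1 (by linarith)

/-- The difference `ζ(s, a) - ζ(s, 1)` is entire, and the termwise difference of the two Dirichlet
series converges locally uniformly for `Re s > 0`; so the identity valid for `Re s > 1` persists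
at `s = 1/2`. -/
lemma hasSum_hurwitzZeta_sub_one_half {a : ℝ} (ha : 0 < a) (ha1 : a ≤ 1) :
    HasSum (fun n : ℕ => (1 / (n + a : ℂ) ^ (1 / 2 : ℂ) - 1 / (n + 1 : ℂ) ^ (1 / 2 : ℂ)))
      (HurwitzZeta.hurwitzZeta a (1 / 2) - HurwitzZeta.hurwitzZeta (1 : ℝ) (1 / 2)) := by
  -- This disc contains `1 / 2` and meets the half plane `1 < re s`, while `re s > 1 / 4` on it.
  set U : Set ℂ := Metric.ball 1 (3 / 4) with hU
  have hre : ∀ s ∈ U, 1 / 4 < s.re := by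
    intro s hs
    have h1 : ‖s - 1‖ < 3 / 4 := by simpa [hU, dist_eq_norm] using hs
    have h2 := (abs_le.1 (Complex.abs_re_le_norm (s - 1))).1
    simp only [Complex.sub_re, Complex.one_re] at h2
    linarith
  have hnorm : ∀ s ∈ U, ‖s‖ ≤ 2 := by
    intro s hs
    have h1 : ‖s - 1‖ < 3 / 4 := by simpa [hU, dist_eq_norm] using hs
    have h2 := norm_add_le (s - 1) 1
    rw [sub_add_cancel, norm_one] at h2
    linarith
  set g : ℕ → ℂ → ℂ := fun n s => 1 / (n + a : ℂ) ^ s - 1 / (n + 1 : ℂ) ^ s with hg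
  have hne : ∀ n : ℕ, (n + a : ℂ) ≠ 0 := by
    intro n; exact_mod_cast (show (n + a : ℝ) ≠ 0 by positivity)
  have hne1 : ∀ n : ℕ, (n + 1 : ℂ) ≠ 0 := fun n => Nat.cast_add_one_ne_zero n
  have hdiff : ∀ n, Differentiable ℂ (g n) := by
    intro n s
    simp only [hg, one_div, ← Complex.cpow_neg]
    exact (DifferentiableAt.const_cpow (by fun_prop) (Or.inl (hne n))).sub
      (DifferentiableAt.const_cpow (by fun_prop) (Or.inl (hne1 n)))
  have hbound : ∀ (n : ℕ) (s : ℂ), s ∈ U → ‖g (n + 1) s‖ ≤ 2 * (1 / ((n + 1 : ℕ) : ℝ) ^ (5 / 4 : ℝ)) := by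
    intro n s hs
    have hn : (1 : ℝ) ≤ (n + 1 : ℕ) := by push_cast; linarith [n.cast_nonneg (α := ℝ)]
    have hx0 : 0 < ((n + 1 : ℕ) : ℝ) + a := by linarith
    have h := norm_cpow_neg_sub_cpow_neg_le (x := ((n + 1 : ℕ) : ℝ) + a) (y := ((n + 1 : ℕ) : ℝ) + 1)
      hx0 (by linarith) (s := s) (by linarith [hre s hs])
    have hgn : g (n + 1) s = (((((n + 1 : ℕ) : ℝ) + a : ℝ)) : ℂ) ^ (-s) -
        (((((n + 1 : ℕ) : ℝ) + 1 : ℝ)) : ℂ) ^ (-s) := by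
      simp only [hg, one_div, ← Complex.cpow_neg]; push_cast; rfl
    rw [hgn]
    refine h.trans ?_
    have h1 : (((n + 1 : ℕ) : ℝ) + a) ^ (-s.re - 1) ≤ 1 / ((n + 1 : ℕ) : ℝ) ^ (5 / 4 : ℝ) := by
      rw [one_div, ← Real.rpow_neg (by linarith)]
      calc (((n + 1 : ℕ) : ℝ) + a) ^ (-s.re - 1) ≤ ((n + 1 : ℕ) : ℝ) ^ (-s.re - 1) :=
            Real.rpow_le_rpow_of_nonpos (by linarith) (by linarith) (by linarith [hre s hs])
        _ ≤ _ := Real.rpow_le_rpow_of_exponent_le hn (by linarith [hre s hs])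
    calc ‖s‖ * (((n + 1 : ℕ) : ℝ) + a) ^ (-s.re - 1) * ((((n + 1 : ℕ) : ℝ) + 1) -
          (((n + 1 : ℕ) : ℝ) + a)) ≤ 2 * (1 / ((n + 1 : ℕ) : ℝ) ^ (5 / 4 : ℝ)) * 1 := by
          gcongr
          · linarith
          · exact hnorm s hs
          · linarith
      _ = _ := mul_one _
  have hsumm : Summable fun n : ℕ => 2 * (1 / ((n + 1 : ℕ) : ℝ) ^ (5 / 4 : ℝ)) :=
    ((summable_nat_add_iff 1).2 (Real.summable_one_div_nat_rpow.2 (by norm_num))).mul_left 2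
  set D : ℂ → ℂ := fun s => g 0 s + ∑' n, g (n + 1) s with hD
  have hDsum : ∀ s ∈ U, HasSum (fun n => g n s) (D s) := by
    intro s hs
    have := (Summable.of_norm_bounded hsumm fun n => hbound n s hs).hasSum
    have h2 := (hasSum_nat_add_iff (f := fun n => g n s) 1).1 this
    simpa [hD, add_comm] using h2
  have hDdiff : DifferentiableOn ℂ D U :=
    (hdiff 0).differentiableOn.add (Complex.differentiableOn_tsum_of_summable_norm hsumm
      (fun n => (hdiff (n + 1)).differentiableOn) Metric.isOpen_ball hbound)
  set E : ℂ → ℂ := fun s => HurwitzZeta.hurwitzZeta a s - HurwitzZeta.hurwitzZeta (1 : ℝ) s with hE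
  have hEdiff : Differentiable ℂ E :=
    HurwitzZeta.differentiable_hurwitzZeta_sub_hurwitzZeta (a : UnitAddCircle) (1 : ℝ)
  have hEsum : ∀ s : ℂ, 1 < s.re → HasSum (fun n => g n s) (E s) := by
    intro s hs
    have h1 := HurwitzZeta.hasSum_hurwitzZeta_of_one_lt_re (a := a) ⟨ha.le, ha1⟩ hs
    have h2 := HurwitzZeta.hasSum_hurwitzZeta_of_one_lt_re (a := 1) ⟨zero_le_one, le_rfl⟩ hs
    simpa [hg] using h1.sub h2
  have hev : D =ᶠ[𝓝 (5 / 4 : ℂ)] E := by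
    have h1 : U ∈ 𝓝 (5 / 4 : ℂ) := Metric.isOpen_ball.mem_nhds (by
      rw [mem_ball_iff_norm]; norm_num)
    have h2 : {s : ℂ | 1 < s.re} ∈ 𝓝 (5 / 4 : ℂ) :=
      (isOpen_lt continuous_const Complex.continuous_re).mem_nhds (by norm_num)
    filter_upwards [h1, h2] with s hs hs2
    exact (hDsum s hs).unique (hEsum s hs2)
  have heq := (hDdiff.analyticOnNhd Metric.isOpen_ball).eqOn_of_preconnected_of_eventuallyEq
    (hEdiff.differentiableOn.analyticOnNhd Metric.isOpen_ball)
    (convex_ball (1 : ℂ) (3 / 4)).isPreconnected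
    (show (5 / 4 : ℂ) ∈ U by rw [hU, mem_ball_iff_norm]; norm_num) hev
  have hmem : (1 / 2 : ℂ) ∈ U := by rw [hU, mem_ball_iff_norm]; norm_num
  have := hDsum _ hmem
  rwa [heq hmem] at this

lemma cpow_one_half_eq_sqrt {x : ℝ} (hx : 0 ≤ x) : (x : ℂ) ^ (1 / 2 : ℂ) = (√x : ℝ) := by
  rw [Real.sqrt_eq_rpow, Complex.ofReal_cpow hx]; norm_num

lemma hurwitzZeta_sub_eq {a : ℝ} (ha : 0 < a) (ha1 : a ≤ 1) :
    HurwitzZeta.hurwitzZeta a (1 / 2) - HurwitzZeta.hurwitzZeta (1 : ℝ) (1 / 2) =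
      ((hurwitzHalf a - hurwitzHalf 1 : ℝ) : ℂ) := by
  have h1 := (hasSum_hurwitzZeta_sub_one_half ha ha1).tendsto_sum_nat
  refine tendsto_nhds_unique h1 ?_
  have h2 : Tendsto (fun N : ℕ => ∑ n ∈ Finset.range N, (1 / √(a + n) - 1 / √(1 + n))) atTop
      (𝓝 (hurwitzHalf a - hurwitzHalf 1)) := by
    have := ((tendsto_hurwitzHalf ha).sub (tendsto_hurwitzHalf one_pos)).sub
      ((tendsto_sqrt_add_nat_sub ha ha1).const_mul 2)
    rw [mul_zero, sub_zero] at this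
    refine this.congr fun N => ?_
    rw [Finset.sum_sub_distrib]; ring
  refine ((Complex.continuous_ofReal.tendsto _).comp h2).congr fun N => ?_
  simp only [Function.comp, Complex.ofReal_sum]
  refine Finset.sum_congr rfl fun n _ => ?_
  have e1 : (n + a : ℂ) = ((a + n : ℝ) : ℂ) := by push_cast; ring
  have e2 : (n + 1 : ℂ) = ((1 + n : ℝ) : ℂ) := by push_cast; ring
  rw [e1, e2, cpow_one_half_eq_sqrt (by positivity), cpow_one_half_eq_sqrt (by positivity)]
  push_cast; rfl

/-- The value of `ζ` at `1/2`. Both sides satisfy the same linear equation: the trivial character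
modulo `2` gives `ζ(1/2, 1/2) = (√2 - 1) ζ(1/2)`, and the distribution relation gives the
corresponding relation for `hurwitzHalf`. -/
lemma riemannZeta_one_half : riemannZeta (1 / 2) = (hurwitzHalf 1 : ℂ) := by
  have h1 := hurwitzZeta_sub_eq (a := 1 / 2) (by norm_num) (by norm_num)
  have h2 := sum_hurwitzHalf_div (t := 1) one_pos (h := 2) two_pos
  have h3 := DirichletCharacter.LFunctionTrivChar_eq_mul_riemannZeta (N := 2) (s := 1 / 2)
    (by norm_num)
  have hz : HurwitzZeta.hurwitzZeta ((1 : ℝ) : UnitAddCircle) = riemannZeta := by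
    rw [AddCircle.coe_period, HurwitzZeta.hurwitzZeta_zero]
  have h4 : DirichletCharacter.LFunctionTrivChar 2 (1 / 2) =
      (2 : ℂ) ^ (-(1 / 2) : ℂ) * HurwitzZeta.hurwitzZeta ((1 / 2 : ℝ) : UnitAddCircle) (1 / 2) := by
    rw [DirichletCharacter.LFunctionTrivChar, DirichletCharacter.LFunction, ZMod.LFunction]
    rw [show (Finset.univ : Finset (ZMod 2)) = {0, 1} from rfl, Finset.sum_pair (by decide)]
    have : ZMod.toAddCircle (1 : ZMod 2) = ((1 / 2 : ℝ) : UnitAddCircle) := by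
      simpa using ZMod.toAddCircle_natCast (N := 2) 1
    rw [this, MulChar.map_zero, MulChar.map_one]
    simp
  have hs : (2 : ℂ) ^ (-(1 / 2) : ℂ) = ((1 / √2 : ℝ) : ℂ) := by
    rw [Complex.cpow_neg]
    have := cpow_one_half_eq_sqrt (x := 2) (by norm_num)
    push_cast at this ⊢
    rw [this, one_div]
  rw [h4, Nat.Prime.primeFactors Nat.prime_two, Finset.prod_singleton, Nat.cast_ofNat, hs] at h3
  rw [hz] at h1
  have h2' : hurwitzHalf (1 / 2) + hurwitzHalf 1 = √2 * hurwitzHalf 1 := by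
    rw [Finset.sum_range_succ, Finset.sum_range_one] at h2; norm_num at h2 ⊢; exact h2
  have hpos : 0 < √(2 : ℝ) := by positivity
  have hsq : √(2 : ℝ) ^ 2 = 2 := Real.sq_sqrt (by norm_num)
  have h5 : HurwitzZeta.hurwitzZeta ((1 / 2 : ℝ) : UnitAddCircle) (1 / 2) =
      ((√2 - 1 : ℝ) : ℂ) * riemannZeta (1 / 2) := by
    have e : ((1 / √2 : ℝ) : ℂ) ≠ 0 := by exact_mod_cast (by positivity : 1 / √(2 : ℝ) ≠ 0)
    apply mul_left_cancel₀ e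
    rw [h3, ← mul_assoc]
    congr 1
    have : (1 - 1 / √2 : ℝ) = 1 / √2 * (√2 - 1) := by field_simp
    exact_mod_cast this
  have hlt : √(2 : ℝ) < 2 := by nlinarith
  have hne : ((√2 - 2 : ℝ) : ℂ) ≠ 0 := by exact_mod_cast (by linarith : √(2 : ℝ) - 2 ≠ 0)
  apply mul_left_cancel₀ hne
  have h6 : ((√2 - 2 : ℝ) : ℂ) * riemannZeta (1 / 2) =
      ((hurwitzHalf (1 / 2) - hurwitzHalf 1 : ℝ) : ℂ) := by
    rw [← h1, h5]; push_cast; ring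
  rw [h6, ← Complex.ofReal_mul]
  congr 1; linarith

/-- On `(0, 1]` the elementary function `hurwitzHalf` is the analytically continued Hurwitz zeta
function at `s = 1/2`. -/
lemma hurwitzZeta_one_half {a : ℝ} (ha : 0 < a) (ha1 : a ≤ 1) :
    HurwitzZeta.hurwitzZeta a (1 / 2) = (hurwitzHalf a : ℂ) := by
  have h1 := hurwitzZeta_sub_eq ha ha1
  have hz : HurwitzZeta.hurwitzZeta ((1 : ℝ) : UnitAddCircle) = riemannZeta := by
    rw [AddCircle.coe_period, HurwitzZeta.hurwitzZeta_zero]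
  rw [hz, riemannZeta_one_half] at h1
  push_cast at h1
  linear_combination h1

/-! ### The regularised mean square of `ζ(1/2, t)` -/

lemma continuousOn_hurwitzHalf : ContinuousOn hurwitzHalf (Ioi 0) :=
  convexOn_hurwitzHalf.continuousOn isOpen_Ioi

lemma hasDerivAt_two_mul_sqrt_add {t c : ℝ} (h : 0 < t + c) :
    HasDerivAt (fun t => 2 * √(t + c)) (1 / √(t + c)) t := by
  have := (((hasDerivAt_id t).add_const c).sqrt (by simpa using h.ne')).const_mul 2
  exact this.congr_deriv (by simp only [id]; ring)

lemma intervalIntegrable_one_div_sqrt : IntervalIntegrable (fun t : ℝ => 1 / √t) volume 0 1 := by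
  refine (intervalIntegrable_deriv_of_nonneg (g := fun t => 2 * √(t + 0)) (g' := fun t => 1 / √t)
    (by fun_prop) (fun t ht => ?_) (fun t _ => by positivity))
  have : 0 < t := by simpa using ht.1
  simpa using hasDerivAt_two_mul_sqrt_add (t := t) (c := 0) (by simpa using this)

lemma integral_one_div_sqrt : ∫ t : ℝ in (0)..1, 1 / √t = 2 := by
  rw [integral_eq_sub_of_hasDerivAt_of_le zero_le_one (f := fun t => 2 * √(t + 0))
    (by fun_prop) (fun t ht => ?_) intervalIntegrable_one_div_sqrt]
  · simp
  · simpa using hasDerivAt_two_mul_sqrt_add (t := t) (c := 0) (by simpa using ht.1)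

/-- The trapezoidal rule underestimates the integral of a concave increasing function by at most
the first increment: on `[k, k + 1]` the function lies below the line continuing its chord over
`[k - 1, k]`, and the resulting bounds telescope. -/
lemma integral_le_trapezoid_add {g : ℝ → ℝ} (hg : ConcaveOn ℝ (Ici 0) g)
    (hm : MonotoneOn g (Ici 0)) (m : ℕ) :
    ∫ u in (0)..(m + 1 : ℕ), g u ≤ ∑ k ∈ Finset.range (m + 1), (g k + g (k + 1 : ℕ)) / 2 +
      (g 1 - g 0) - (g (m + 1 : ℕ) - g m) / 2 := by
  have hint : ∀ a b : ℝ, 0 ≤ a → a ≤ b → IntervalIntegrable g volume a b := fun a b ha hab =>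
    MonotoneOn.intervalIntegrable (hm.mono fun x hx => by
      rw [uIcc_of_le hab] at hx; exact ha.trans hx.1)
  induction m with
  | zero =>
    have : ∫ u in (0)..((0 + 1 : ℕ) : ℝ), g u ≤ ∫ u in (0)..((0 + 1 : ℕ) : ℝ), g 1 := by
      refine integral_mono_on (by norm_num) (hint _ _ le_rfl (by norm_num)) (by simp)
        fun x hx => hm hx.1 (mem_Ici.2 zero_le_one) (by simpa using hx.2)
    rw [integral_const] at this
    simp at this ⊢
    linarith
  | succ m ih =>
    rw [← integral_add_adjacent_intervals (b := ((m + 1 : ℕ) : ℝ)) (hint _ _ le_rfl (by positivity))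
      (hint _ _ (by positivity) (by push_cast; linarith)), Finset.sum_range_succ]
    have key : ∫ u in ((m + 1 : ℕ) : ℝ)..((m + 1 + 1 : ℕ) : ℝ), g u ≤
        ∫ u in ((m + 1 : ℕ) : ℝ)..((m + 1 + 1 : ℕ) : ℝ),
          (g (m + 1 : ℕ) + (u - (m + 1 : ℕ)) * (g (m + 1 : ℕ) - g m)) := by
      refine integral_mono_on (by push_cast; linarith)
        (hint _ _ (by positivity) (by push_cast; linarith))
        (Continuous.intervalIntegrable (by fun_prop) _ _) fun x hx => ?_
      rcases hx.1.eq_or_lt with h | h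
      · rw [← h]; simp
      have h1 := hg.slope_anti_adjacent (x := (m : ℝ)) (y := (m + 1 : ℕ)) (z := x)
        (mem_Ici.2 (by positivity)) (mem_Ici.2 (by linarith [show (0 : ℝ) ≤ (m + 1 : ℕ) by positivity]))
        (by push_cast; linarith) h
      rw [div_le_iff₀ (by linarith)] at h1
      have e : ((m + 1 : ℕ) : ℝ) - m = 1 := by push_cast; ring
      rw [e, div_one] at h1
      linarith
    have h2 : ∫ u in ((m + 1 : ℕ) : ℝ)..((m + 1 + 1 : ℕ) : ℝ),
          (g (m + 1 : ℕ) + (u - (m + 1 : ℕ)) * (g (m + 1 : ℕ) - g m)) =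
          g (m + 1 : ℕ) + (g (m + 1 : ℕ) - g m) / 2 := by
      rw [integral_add (by simp) (Continuous.intervalIntegrable (by fun_prop) _ _),
        intervalIntegral.integral_mul_const, integral_sub (by simp) (by simp), integral_id]
      simp; ring
    rw [h2] at key
    linarith

lemma trapezoid_le_integral {g : ℝ → ℝ} (hg : ConcaveOn ℝ (Ici 0) g)
    (hm : MonotoneOn g (Ici 0)) (m : ℕ) :
    ∑ k ∈ Finset.range m, (g k + g (k + 1 : ℕ)) / 2 ≤ ∫ u in (0)..(m : ℝ), g u := by
  have hint : ∀ a b : ℝ, 0 ≤ a → a ≤ b → IntervalIntegrable g volume a b := fun a b ha hab =>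
    MonotoneOn.intervalIntegrable (hm.mono fun x hx => by
      rw [uIcc_of_le hab] at hx; exact ha.trans hx.1)
  induction m with
  | zero => simp
  | succ m ih =>
    rw [← integral_add_adjacent_intervals (b := (m : ℝ)) (hint _ _ le_rfl (by positivity))
      (hint _ _ (by positivity) (by push_cast; linarith)), Finset.sum_range_succ]
    have key : ∫ u in (m : ℝ)..((m + 1 : ℕ) : ℝ), (g m + (u - m) * (g (m + 1 : ℕ) - g m)) ≤
        ∫ u in (m : ℝ)..((m + 1 : ℕ) : ℝ), g u := by
      refine integral_mono_on (by push_cast; linarith) (Continuous.intervalIntegrable (by fun_prop) _ _)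
        (hint _ _ (by positivity) (by push_cast; linarith)) fun x hx => ?_
      have hx2 : x ≤ m + 1 := by simpa using hx.2
      have h1 := hg.2 (mem_Ici.2 (m.cast_nonneg (α := ℝ)))
        (mem_Ici.2 ((m + 1).cast_nonneg (α := ℝ))) (show (0 : ℝ) ≤ 1 - (x - m) by linarith)
        (show (0 : ℝ) ≤ x - m by linarith [hx.1]) (by ring)
      simp only [smul_eq_mul] at h1
      rw [show (1 - (x - m)) * (m : ℝ) + (x - m) * ((m + 1 : ℕ) : ℝ) = x by push_cast; ring] at h1
      linarith
    have h2 : ∫ u in (m : ℝ)..((m + 1 : ℕ) : ℝ), (g m + (u - m) * (g (m + 1 : ℕ) - g m)) =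
          (g m + g (m + 1 : ℕ)) / 2 := by
      rw [integral_add (by simp) (Continuous.intervalIntegrable (by fun_prop) _ _),
        intervalIntegral.integral_mul_const, integral_sub (by simp) (by simp), integral_id]
      simp; ring
    rw [h2] at key
    linarith

lemma integral_log_one_add_sqrt_div {c : ℝ} (hc : 0 < c) :
    ∫ u in (0)..c, Real.log (1 + √(u / c)) = c / 2 := by
  rw [integral_comp_div (f := fun x => Real.log (1 + √x)) hc.ne', zero_div, div_self hc.ne']
  have : ∫ x in (0 : ℝ)..1, Real.log (1 + √x) = 1 / 2 := by
    have hpos : ∀ x : ℝ, 1 + √x ≠ 0 := fun x => by positivity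
    rw [integral_eq_sub_of_hasDerivAt_of_le zero_le_one
      (f := fun x => (x - 1) * Real.log (1 + √x) - x / 2 + √x)
      (Continuous.continuousOn (by fun_prop (disch := assumption))) (fun x hx => ?_)
      (Continuous.intervalIntegrable (by fun_prop (disch := assumption)) _ _)]
    · norm_num
    · have hx0 : 0 < √x := Real.sqrt_pos.2 hx.1
      have h1 := (Real.hasDerivAt_sqrt hx.1.ne')
      have h2 := ((((hasDerivAt_id x).sub_const 1).mul ((h1.const_add 1).log (hpos x))).sub
        ((hasDerivAt_id x).div_const 2)).add h1
      refine h2.congr_deriv ?_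
      have : √x ^ 2 = x := Real.sq_sqrt hx.1.le
      simp only [id]
      field_simp
      linear_combination -this
  rw [this, smul_eq_mul]; ring

lemma tendsto_sum_log_one_add_sqrt :
    Tendsto (fun N : ℕ => ∑ k ∈ Finset.range N, Real.log (1 + √((k : ℝ) / N)) - N / 2) atTop
      (𝓝 (-(Real.log 2 / 2))) := by
  have hlim : Tendsto (fun N : ℕ => 1 / √(N : ℝ)) atTop (𝓝 0) := by
    simpa using tendsto_one_div_sqrt_add_nat 0
  have h : ∀ᶠ N : ℕ in atTop, |∑ k ∈ Finset.range N, Real.log (1 + √((k : ℝ) / N)) - N / 2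
      - (-(Real.log 2 / 2))| ≤ 1 / √(N : ℝ) := by
    filter_upwards [eventually_ge_atTop 1] with N hN
    obtain ⟨m, rfl⟩ : ∃ m, N = m + 1 := ⟨N - 1, by omega⟩
    set c : ℝ := ((m + 1 : ℕ) : ℝ) with hc
    have hc0 : 0 < c := by positivity
    set g : ℝ → ℝ := fun u => Real.log (1 + √(u / c)) with hg
    have hmono : MonotoneOn g (Ici 0) := fun x _ y _ hxy => by
      refine Real.log_le_log (by positivity) ?_
      gcongr
    have hconc : ConcaveOn ℝ (Ici 0) g := by
      refine ⟨convex_Ici 0, fun x hx y hy a b ha hb hab => ?_⟩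
      have h1 := Real.strictConcaveOn_sqrt.concaveOn.2 (x := x / c) (y := y / c)
        (div_nonneg hx hc0.le) (div_nonneg hy hc0.le) ha hb hab
      have h2 := strictConcaveOn_log_Ioi.concaveOn.2 (x := 1 + √(x / c)) (y := 1 + √(y / c))
        (mem_Ioi.2 (by positivity)) (mem_Ioi.2 (by positivity)) ha hb hab
      refine h2.trans (Real.log_le_log ?_ ?_)
      · exact mem_Ioi.1 ((convex_Ioi (0 : ℝ)) (mem_Ioi.2 (by positivity))
          (mem_Ioi.2 (by positivity)) ha hb hab)
      · simp only [smul_eq_mul] at h1 ⊢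
        rw [show (a * x + b * y) / c = a * (x / c) + b * (y / c) by ring]
        linarith
    have hI := integral_log_one_add_sqrt_div hc0
    have h1 := integral_le_trapezoid_add hconc hmono m
    have h2 := trapezoid_le_integral hconc hmono (m + 1)
    have h3 : ∑ k ∈ Finset.range (m + 1), (g k + g (k + 1 : ℕ)) / 2 =
        ∑ k ∈ Finset.range (m + 1), g k + (g c - g 0) / 2 := by
      have := Finset.sum_range_sub (fun k : ℕ => g k) (m + 1)
      rw [Nat.cast_zero] at this
      rw [← this, Finset.sum_div, ← Finset.sum_add_distrib]
      exact Finset.sum_congr rfl fun k _ => by ring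
    have hg0 : g 0 = 0 := by simp [hg]
    have hgc : g c = Real.log 2 := by simp only [hg]; rw [div_self hc0.ne']; norm_num
    have hg1 : g 1 ≤ 1 / √c := by
      have := Real.log_le_sub_one_of_pos (x := 1 + √(1 / c)) (by positivity)
      simp only [hg]
      rw [Real.sqrt_div zero_le_one, Real.sqrt_one] at this ⊢
      linarith
    have h4 : g m ≤ g (m + 1 : ℕ) := hmono (mem_Ici.2 (by positivity)) (mem_Ici.2 (by positivity))
      (by push_cast; linarith)
    rw [h3, hgc, hg0] at h1 h2
    change ∫ u in (0)..c, g u = c / 2 at hI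
    rw [hI] at h1 h2
    rw [abs_le]
    have h5 : 0 ≤ 1 / √c := by positivity
    constructor <;> linarith
  rw [tendsto_iff_dist_tendsto_zero]
  exact squeeze_zero' (Eventually.of_forall fun _ => dist_nonneg) h hlim

/-- Stirling's formula in logarithmic form. -/
lemma tendsto_log_factorial :
    Tendsto (fun N : ℕ => 2 * Real.log (N.factorial) - (2 * N * Real.log N - 2 * N + Real.log N))
      atTop (𝓝 (Real.log (2 * Real.pi))) := by
  have h := Stirling.tendsto_stirlingSeq_sqrt_pi
  have hpi : 0 < √Real.pi := Real.sqrt_pos.2 Real.pi_pos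
  have h2 := ((h.log hpi.ne').const_mul 2).add_const (Real.log 2)
  have e : 2 * Real.log √Real.pi + Real.log 2 = Real.log (2 * Real.pi) := by
    rw [Real.log_sqrt Real.pi_pos.le, Real.log_mul (by norm_num) Real.pi_pos.ne']; ring
  rw [e] at h2
  refine h2.congr' ?_
  filter_upwards [eventually_ge_atTop 1] with N hN
  have hN' : (0 : ℝ) < N := by exact_mod_cast hN
  rw [Stirling.log_stirlingSeq_formula, Real.log_mul (by norm_num) hN'.ne',
    Real.log_div hN'.ne' (Real.exp_ne_zero _), Real.log_exp]
  ring

/-- An antiderivative in `t` of `1 / √((t + m) (t + n))`, except that the pair `m = n = 0`, which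
would give `1 / t`, is assigned `0`. -/
noncomputable def logSqrtAddSqrt (m n : ℕ) (t : ℝ) : ℝ :=
  if m = 0 ∧ n = 0 then 0 else 2 * Real.log (√(t + m) + √(t + n))

lemma add_sqrt_pos_of_not {m n : ℕ} (h : ¬(m = 0 ∧ n = 0)) {t : ℝ} (ht : 0 ≤ t) :
    0 < √(t + m) + √(t + n) := by
  have : 0 < m ∨ 0 < n := by omega
  rcases this with h | h
  · have : 0 < √(t + m) := Real.sqrt_pos.2 (by positivity)
    positivity
  · have : 0 < √(t + n) := Real.sqrt_pos.2 (by positivity)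
    positivity

lemma continuousOn_logSqrtAddSqrt (m n : ℕ) : ContinuousOn (logSqrtAddSqrt m n) (Icc 0 1) := by
  unfold logSqrtAddSqrt
  split_ifs with h
  · exact continuousOn_const
  · exact continuousOn_const.mul (ContinuousOn.log (by fun_prop) fun t ht =>
      (add_sqrt_pos_of_not h ht.1).ne')

lemma hasDerivAt_logSqrtAddSqrt (m n : ℕ) {t : ℝ} (ht : 0 < t) :
    HasDerivAt (logSqrtAddSqrt m n)
      (1 / √(t + m) * (1 / √(t + n)) - if m = 0 ∧ n = 0 then 1 / t else 0) t := by
  unfold logSqrtAddSqrt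
  split_ifs with h
  · obtain ⟨rfl, rfl⟩ := h
    have : 1 / √(t + (0 : ℕ)) * (1 / √(t + (0 : ℕ))) - 1 / t = 0 := by
      rw [Nat.cast_zero, add_zero, one_div_mul_one_div, Real.mul_self_sqrt ht.le, sub_self]
    rw [this]; exact hasDerivAt_const t 0
  · have hm : 0 < √(t + m) := Real.sqrt_pos.2 (by positivity)
    have hn : 0 < √(t + n) := Real.sqrt_pos.2 (by positivity)
    have h1 := ((hasDerivAt_id t).add_const (m : ℝ)).sqrt (by simp; positivity)
    have h2 := ((hasDerivAt_id t).add_const (n : ℝ)).sqrt (by simp; positivity)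
    have h3 := ((h1.add h2).log (by simpa using (add_pos hm hn).ne')).const_mul 2
    refine h3.congr_deriv ?_
    simp only [id, Pi.add_apply]
    field_simp
    ring

/-- The truncation of `ζ(1/2, t)` to the first `N` terms. -/
noncomputable def hurwitzHalfTrunc (N : ℕ) (t : ℝ) : ℝ :=
  ∑ n ∈ Finset.range N, 1 / √(t + n) - 2 * √N

lemma hasDerivAt_sum_logSqrtAddSqrt {N : ℕ} (hN : 0 < N) {t : ℝ} (ht : 0 < t) :
    HasDerivAt (fun t => ∑ m ∈ Finset.range N, ∑ n ∈ Finset.range N, logSqrtAddSqrt m n t -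
        4 * √N * ∑ n ∈ Finset.range N, 2 * √(t + n) + 4 * N * t)
      (hurwitzHalfTrunc N t ^ 2 - 1 / t) t := by
  have h1 : HasDerivAt (fun t => ∑ m ∈ Finset.range N, ∑ n ∈ Finset.range N, logSqrtAddSqrt m n t)
      (∑ m ∈ Finset.range N, ∑ n ∈ Finset.range N,
        (1 / √(t + m) * (1 / √(t + n)) - if m = 0 ∧ n = 0 then 1 / t else 0)) t :=
    HasDerivAt.fun_sum fun m _ => HasDerivAt.fun_sum fun n _ => hasDerivAt_logSqrtAddSqrt m n ht
  have h2 : HasDerivAt (fun t => ∑ n ∈ Finset.range N, 2 * √(t + n))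
      (∑ n ∈ Finset.range N, 1 / √(t + n)) t :=
    HasDerivAt.fun_sum fun n _ => hasDerivAt_two_mul_sqrt_add (by positivity)
  refine ((h1.sub (h2.const_mul (4 * √(N : ℝ)))).add
    ((hasDerivAt_id t).const_mul (4 * (N : ℝ)))).congr_deriv ?_
  have h3 : ∑ m ∈ Finset.range N, ∑ n ∈ Finset.range N, (if m = 0 ∧ n = 0 then 1 / t else 0) =
      1 / t := by
    simp [ite_and, hN]
  have hs : √(N : ℝ) ^ 2 = N := Real.sq_sqrt N.cast_nonneg
  simp only [Finset.sum_sub_distrib]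
  rw [h3, ← Finset.sum_mul_sum, hurwitzHalfTrunc]
  linear_combination -4 * hs

/-- The increment over `[0, 1]` of the antiderivative. Passing from `t = 0` to `t = 1` shifts
`(m, n)` to `(m + 1, n + 1)`, so the double sum telescopes along diagonals and only the boundary
of the square of summation survives. -/
lemma sum_logSqrtAddSqrt_sub {N : ℕ} (hN : 0 < N) :
    ∑ m ∈ Finset.range N, ∑ n ∈ Finset.range N, logSqrtAddSqrt m n 1 -
      ∑ m ∈ Finset.range N, ∑ n ∈ Finset.range N, logSqrtAddSqrt m n 0 =
    2 * N * Real.log N + 4 * ∑ k ∈ Finset.range N, Real.log (1 + √((k : ℝ) / N)) + Real.log N -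
      2 * Real.log N.factorial := by
  set D : ℕ → ℕ → ℝ := fun m n => 2 * Real.log (√(m : ℝ) + √n) with hD
  have hN' : (0 : ℝ) < N := by exact_mod_cast hN
  have h0 : ∀ m n, logSqrtAddSqrt m n 0 = D m n := by
    intro m n
    unfold logSqrtAddSqrt
    split_ifs with h
    · simp [hD, h.1, h.2]
    · simp [hD]
  have h1 : ∀ m n, logSqrtAddSqrt m n 1 = D (m + 1) (n + 1) -
      if m = 0 ∧ n = 0 then 2 * Real.log 2 else 0 := by
    intro m n
    unfold logSqrtAddSqrt
    split_ifs with h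
    · simp [hD, h.1, h.2]; norm_num
    · simp [hD, add_comm]
  have hw1 : ∑ m ∈ Finset.range (N + 1), ∑ n ∈ Finset.range (N + 1), D m n =
      ∑ m ∈ Finset.range N, ∑ n ∈ Finset.range N, D (m + 1) (n + 1) +
        2 * ∑ k ∈ Finset.range N, D 0 (k + 1) := by
    simp only [Finset.sum_range_succ' _ N, Finset.sum_add_distrib]
    have : D 0 0 = 0 := by simp [hD]
    rw [this]
    have : ∑ k ∈ Finset.range N, D (k + 1) 0 = ∑ k ∈ Finset.range N, D 0 (k + 1) :=
      Finset.sum_congr rfl fun k _ => by simp [hD]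
    rw [this]; ring
  have hw2 : ∑ m ∈ Finset.range (N + 1), ∑ n ∈ Finset.range (N + 1), D m n =
      ∑ m ∈ Finset.range N, ∑ n ∈ Finset.range N, D m n +
        2 * ∑ k ∈ Finset.range N, D k N + D N N := by
    simp only [Finset.sum_range_succ _ N, Finset.sum_add_distrib]
    have : ∑ k ∈ Finset.range N, D N k = ∑ k ∈ Finset.range N, D k N :=
      Finset.sum_congr rfl fun k _ => by simp [hD, add_comm]
    rw [this]; ring
  have hfac : ∑ k ∈ Finset.range N, D 0 (k + 1) = Real.log N.factorial := by
    rw [← Finset.prod_range_add_one_eq_factorial, Nat.cast_prod, Real.log_prod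
      (fun k _ => by positivity)]
    refine Finset.sum_congr rfl fun k _ => ?_
    simp only [hD, Nat.cast_zero, Real.sqrt_zero, zero_add]
    rw [Real.log_sqrt (by positivity)]; ring
  have hkN : ∀ k : ℕ, D k N = Real.log N + 2 * Real.log (1 + √((k : ℝ) / N)) := by
    intro k
    have hsq : 0 < √(N : ℝ) := Real.sqrt_pos.2 hN'
    have : √(k : ℝ) + √N = √N * (1 + √((k : ℝ) / N)) := by
      rw [Real.sqrt_div (by positivity)]; field_simp; ring
    simp only [hD]
    rw [this, Real.log_mul hsq.ne' (by positivity), Real.log_sqrt hN'.le]; ring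
  have hNN : D N N = Real.log N + 2 * Real.log 2 := by
    rw [hkN, div_self hN'.ne', Real.sqrt_one]; norm_num
  have hone : ∑ m ∈ Finset.range N, ∑ n ∈ Finset.range N,
      (if m = 0 ∧ n = 0 then 2 * Real.log 2 else 0) = 2 * Real.log 2 := by
    simp [ite_and, hN]
  have hsum : ∑ k ∈ Finset.range N, D k N =
      N * Real.log N + 2 * ∑ k ∈ Finset.range N, Real.log (1 + √((k : ℝ) / N)) := by
    simp only [hkN, Finset.sum_add_distrib, ← Finset.mul_sum]
    simp
  simp only [h0, h1, Finset.sum_sub_distrib]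
  rw [hone]
  linarith

lemma intervalIntegrable_one_div_sqrt_mul {G : ℝ → ℝ} (hG : ContinuousOn G (Icc 0 1)) :
    IntervalIntegrable (fun t => 1 / √t * G t) volume 0 1 :=
  intervalIntegrable_one_div_sqrt.mul_continuousOn (by rwa [uIcc_of_le zero_le_one])

lemma intervalIntegrable_sq_sub_one_div {f G : ℝ → ℝ} (hG : ContinuousOn G (Icc 0 1))
    (hf : ∀ t ∈ Ioc (0 : ℝ) 1, f t = 1 / √t + G t) :
    IntervalIntegrable (fun t => f t ^ 2 - 1 / t) volume 0 1 := by
  have h1 : IntervalIntegrable (fun t => 2 * (1 / √t * G t) + G t ^ 2) volume 0 1 :=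
    ((intervalIntegrable_one_div_sqrt_mul hG).const_mul 2).add
      ((hG.pow 2).intervalIntegrable_of_Icc zero_le_one)
  refine h1.congr fun t ht => ?_
  rw [uIoc_of_le zero_le_one] at ht
  have : 1 / t = (1 / √t) ^ 2 := by rw [div_pow, Real.sq_sqrt ht.1.le, one_pow]
  rw [hf t ht, this]; ring

lemma continuousOn_hurwitzHalf_add_one :
    ContinuousOn (fun t => hurwitzHalf (t + 1)) (Icc 0 1) :=
  continuousOn_hurwitzHalf.comp (by fun_prop) fun t ht => mem_Ioi.2 (by linarith [ht.1])

lemma intervalIntegrable_hurwitzHalf_sq_sub :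
    IntervalIntegrable (fun t => hurwitzHalf t ^ 2 - 1 / t) volume 0 1 :=
  intervalIntegrable_sq_sub_one_div continuousOn_hurwitzHalf_add_one
    fun _ ht => hurwitzHalf_eq_add ht.1

lemma intervalIntegrable_hurwitzHalfTrunc_sq_sub {N : ℕ} (hN : 0 < N) :
    IntervalIntegrable (fun t => hurwitzHalfTrunc N t ^ 2 - 1 / t) volume 0 1 := by
  obtain ⟨m, rfl⟩ : ∃ m, N = m + 1 := ⟨N - 1, by omega⟩
  refine intervalIntegrable_sq_sub_one_div (G := fun t => ∑ n ∈ Finset.range m,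
    1 / √(t + (n + 1 : ℕ)) - 2 * √((m + 1 : ℕ) : ℝ)) ?_ fun t ht => ?_
  · refine (continuousOn_finsetSum _ fun n _ => ?_).sub continuousOn_const
    refine continuousOn_const.div (by fun_prop) fun t ht => ?_
    have := ht.1
    exact (Real.sqrt_pos.2 (by positivity)).ne'
  · simp only [hurwitzHalfTrunc]
    rw [Finset.sum_range_succ', Nat.cast_zero, add_zero]
    ring

lemma integral_hurwitzHalfTrunc_sq_sub {N : ℕ} (hN : 0 < N) :
    ∫ t in (0)..1, (hurwitzHalfTrunc N t ^ 2 - 1 / t) =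
      4 * (∑ k ∈ Finset.range N, Real.log (1 + √((k : ℝ) / N)) - N / 2) -
      (2 * Real.log (N.factorial) - (2 * N * Real.log N - 2 * N + Real.log N)) := by
  rw [integral_eq_sub_of_hasDerivAt_of_le zero_le_one ?_
    (fun t ht => hasDerivAt_sum_logSqrtAddSqrt hN ht.1)
    (intervalIntegrable_hurwitzHalfTrunc_sq_sub hN)]
  · have h1 := sum_logSqrtAddSqrt_sub hN
    have h2 := Finset.sum_range_sub (fun k : ℕ => 2 * √(k : ℝ)) N
    have hs : √(N : ℝ) * √N = N := Real.mul_self_sqrt N.cast_nonneg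
    simp only [Finset.sum_sub_distrib, Nat.cast_zero, Real.sqrt_zero, mul_zero, sub_zero,
      Nat.cast_add, Nat.cast_one] at h2
    simp only [zero_add, mul_zero, add_zero, mul_one, add_comm (1 : ℝ) (_ : ℝ)] at h1 ⊢
    linear_combination h1 - 4 * √(N : ℝ) * h2 - 8 * hs
  · refine ((continuousOn_finsetSum _ fun m _ => continuousOn_finsetSum _ fun n _ =>
      continuousOn_logSqrtAddSqrt m n).sub ?_).add ?_
    · fun_prop
    · fun_prop

lemma abs_hurwitzHalfTrunc_sub_le {N : ℕ} (hN : 0 < N) {t : ℝ} (ht : 0 < t) (ht1 : t ≤ 1) :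
    |hurwitzHalfTrunc N t - hurwitzHalf t| ≤ 2 / √N := by
  have hN' : (0 : ℝ) < N := by exact_mod_cast hN
  have h1 := abs_sum_sub_sub_hurwitzHalf_le ht N
  have ha : 0 < √(N : ℝ) := Real.sqrt_pos.2 hN'
  have hab : √(N : ℝ) ≤ √(t + N) := by gcongr; linarith
  have h2 : 1 / √(t + N) ≤ 1 / √N := by gcongr
  have h3 : √(t + N) ≤ √(N + 1 : ℝ) := Real.sqrt_le_sqrt (by linarith)
  have h4 := two_mul_sqrt_succ_sub_le hN'
  rw [abs_le] at h1 ⊢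
  unfold hurwitzHalfTrunc
  rw [show 2 / √(N : ℝ) = 1 / √N + 1 / √N by ring]
  constructor <;> linarith

/-- The regularised mean square of `ζ(1/2, t)` over `[0, 1]`; this is where `log (8π)` in the
constant `A` comes from. -/
theorem integral_hurwitzHalf_sq_sub :
    ∫ t in (0)..1, (hurwitzHalf t ^ 2 - 1 / t) = -Real.log (8 * Real.pi) := by
  have hlim : Tendsto (fun N : ℕ => ∫ t in (0)..1, (hurwitzHalfTrunc N t ^ 2 - 1 / t)) atTop
      (𝓝 (-Real.log (8 * Real.pi))) := by
    have := (tendsto_sum_log_one_add_sqrt.const_mul 4).sub tendsto_log_factorial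
    have e : 4 * -(Real.log 2 / 2) - Real.log (2 * Real.pi) = -Real.log (8 * Real.pi) := by
      rw [show (8 : ℝ) * Real.pi = 2 ^ 2 * (2 * Real.pi) by ring,
        Real.log_mul (x := 2 ^ 2) (by norm_num) (by positivity), Real.log_pow]
      push_cast; ring
    rw [e] at this
    refine this.congr' ?_
    filter_upwards [eventually_gt_atTop 0] with N hN
    exact (integral_hurwitzHalfTrunc_sq_sub hN).symm
  refine tendsto_nhds_unique ?_ hlim
  rw [tendsto_iff_dist_tendsto_zero]
  have hb : Tendsto (fun N : ℕ => 20 * (1 / √(N : ℝ))) atTop (𝓝 0) := by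
    have := (tendsto_one_div_sqrt_add_nat 0).const_mul 20
    simpa using this
  refine squeeze_zero' (Eventually.of_forall fun _ => dist_nonneg) ?_ hb
  filter_upwards [eventually_gt_atTop 0] with N hN
  have hN' : (1 : ℝ) ≤ N := by exact_mod_cast hN
  have hs : 1 ≤ √(N : ℝ) := Real.one_le_sqrt.2 hN'
  have hs2 : 2 / √(N : ℝ) ≤ 2 := by rw [div_le_iff₀ (by linarith)]; linarith
  rw [Real.dist_eq, ← integral_sub (intervalIntegrable_hurwitzHalfTrunc_sq_sub hN)
    intervalIntegrable_hurwitzHalf_sq_sub]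
  have hint : ∫ t in (0)..1, (2 / √(N : ℝ)) * (4 * (1 / √t) + 2 : ℝ) = 20 * (1 / √(N : ℝ)) := by
    rw [intervalIntegral.integral_const_mul, integral_add
      (intervalIntegrable_one_div_sqrt.const_mul 4) (by simp),
      intervalIntegral.integral_const_mul, integral_one_div_sqrt]
    simp; ring
  rw [← hint, ← Real.norm_eq_abs]
  refine norm_integral_le_of_norm_le zero_le_one (Eventually.of_forall fun t ht => ?_)
    (((intervalIntegrable_one_div_sqrt.const_mul 4).add (by simp)).const_mul _)
  have h1 := abs_hurwitzHalfTrunc_sub_le hN ht.1 ht.2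
  have h2 := abs_hurwitzHalf_le ht.1 ht.2
  have e : hurwitzHalfTrunc N t ^ 2 - 1 / t - (hurwitzHalf t ^ 2 - 1 / t) =
    (hurwitzHalfTrunc N t - hurwitzHalf t) *
      ((hurwitzHalfTrunc N t - hurwitzHalf t) + 2 * hurwitzHalf t) := by ring
  rw [e, norm_mul, Real.norm_eq_abs, Real.norm_eq_abs]
  refine mul_le_mul h1 ((abs_add_le _ _).trans ?_) (abs_nonneg _) (by positivity)
  rw [abs_mul, abs_two, show 4 * (1 / √t) = 2 * (2 / √t) by ring]
  linarith

/-! ### Sampling monotone and singular functions along progressions -/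

/-- The points `(n + ρ) / X`, `n < N`, are exactly the points of the progression
`ρ / X, (ρ + 1) / X, …` lying in `(0, 1]`; here `1 ≤ X` and `0 < ρ ≤ 1`. -/
structure IsSampling (X ρ : ℝ) (N : ℕ) : Prop where
  one_le : 1 ≤ X
  pos : 0 < ρ
  le_one : ρ ≤ 1
  le : (N : ℝ) - 1 + ρ ≤ X
  lt : X < N + ρ

/-- The difference between the sum of `φ` over the points `(n + ρ) / X`, `n < N`, and
`X ∫₀¹ φ`. -/
noncomputable def discrepancy (X ρ : ℝ) (N : ℕ) (φ : ℝ → ℝ) : ℝ :=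
  ∑ n ∈ Finset.range N, φ ((n + ρ) / X) - X * ∫ t in (0)..1, φ t

namespace IsSampling

variable {X ρ : ℝ} {N : ℕ}

lemma X_pos (hS : IsSampling X ρ N) : 0 < X := by linarith [hS.one_le]

lemma N_pos (hS : IsSampling X ρ N) : 0 < N := by
  have h : (0 : ℝ) < N := by linarith [hS.one_le, hS.le_one, hS.lt]
  exact_mod_cast h

lemma mem_Ioc (hS : IsSampling X ρ N) {n : ℕ} (hn : n < N) : (n + ρ) / X ∈ Ioc (0 : ℝ) 1 := by
  have h1 : (n : ℝ) + 1 ≤ N := by exact_mod_cast hn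
  have := hS.pos
  have := hS.X_pos
  refine ⟨by positivity, ?_⟩
  rw [div_le_one hS.X_pos]
  linarith [hS.le]

lemma discrepancy_congr (hS : IsSampling X ρ N) {φ ψ : ℝ → ℝ} (h : ∀ t ∈ Ioc (0 : ℝ) 1, φ t = ψ t) :
    discrepancy X ρ N φ = discrepancy X ρ N ψ := by
  unfold discrepancy
  rw [Finset.sum_congr rfl fun n hn => h _ (hS.mem_Ioc (Finset.mem_range.1 hn))]
  congr 2
  refine integral_congr_ae (Eventually.of_forall fun t ht => ?_)
  rw [uIoc_of_le zero_le_one] at ht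
  exact h t ht

end IsSampling

section Linear

variable {X ρ : ℝ} {N : ℕ} {φ ψ : ℝ → ℝ}

lemma discrepancy_add (hφ : IntervalIntegrable φ volume 0 1) (hψ : IntervalIntegrable ψ volume 0 1) :
    discrepancy X ρ N (fun t => φ t + ψ t) = discrepancy X ρ N φ + discrepancy X ρ N ψ := by
  unfold discrepancy
  rw [integral_add hφ hψ, Finset.sum_add_distrib]; ring

lemma discrepancy_const_mul (c : ℝ) :
    discrepancy X ρ N (fun t => c * φ t) = c * discrepancy X ρ N φ := by
  unfold discrepancy
  rw [intervalIntegral.integral_const_mul, ← Finset.mul_sum]; ring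

end Linear

lemma IsSampling.abs_discrepancy_le_of_antitoneOn_Icc {X ρ : ℝ} {N : ℕ} (hS : IsSampling X ρ N)
    {φ : ℝ → ℝ} {M : ℝ} (hφ : AntitoneOn φ (Icc 0 1)) (h0 : ∀ t ∈ Icc (0 : ℝ) 1, 0 ≤ φ t)
    (hM : ∀ t ∈ Icc (0 : ℝ) 1, φ t ≤ M) : |discrepancy X ρ N φ| ≤ M := by
  have hX := hS.X_pos
  have hρ := hS.pos
  obtain ⟨m, rfl⟩ : ∃ m, N = m + 1 := ⟨N - 1, by have := hS.N_pos; omega⟩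
  have hle : (m : ℝ) + ρ ≤ X := by have := hS.le; push_cast at this; linarith
  have hlt : X < m + 1 + ρ := by have := hS.lt; push_cast at this; linarith
  set ψ : ℝ → ℝ := fun u => φ (u / X) with hψ
  have hmem : ∀ u ∈ Icc 0 X, u / X ∈ Icc (0 : ℝ) 1 := fun u hu =>
    ⟨div_nonneg hu.1 hX.le, (div_le_one hX).2 hu.2⟩
  have hanti : AntitoneOn ψ (Icc 0 X) := fun u hu v hv huv =>
    hφ (hmem u hu) (hmem v hv) (by gcongr)
  have hint : ∀ a b : ℝ, 0 ≤ a → a ≤ b → b ≤ X → IntervalIntegrable ψ volume a b :=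
    fun a b ha hab hb => AntitoneOn.intervalIntegrable (hanti.mono fun x hx => by
      rw [uIcc_of_le hab] at hx; exact ⟨ha.trans hx.1, hx.2.trans hb⟩)
  have hIX : X * ∫ t in (0)..1, φ t = ∫ u in (0)..X, ψ u := by
    rw [hψ, integral_comp_div _ hX.ne', zero_div, div_self hX.ne', smul_eq_mul]
  have hM0 : 0 ≤ M := (h0 0 (by simp)).trans (hM 0 (by simp))
  have hsplit : ∫ u in (0)..X, ψ u = (∫ u in (0)..ρ, ψ u) + (∫ u in ρ..(ρ + m), ψ u) +
      ∫ u in (ρ + m)..X, ψ u := by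
    rw [integral_add_adjacent_intervals (hint _ _ le_rfl hρ.le (by linarith [m.cast_nonneg (α := ℝ)]))
      (hint _ _ hρ.le (by linarith [m.cast_nonneg (α := ℝ)]) (by linarith)),
      integral_add_adjacent_intervals (hint _ _ le_rfl (by positivity) (by linarith))
      (hint _ _ (by positivity) (by linarith) le_rfl)]
  have hsum : ∑ n ∈ Finset.range (m + 1), φ ((n + ρ) / X) =
      ∑ n ∈ Finset.range (m + 1), ψ (ρ + n) := by
    refine Finset.sum_congr rfl fun n _ => ?_
    simp only [hψ]; rw [add_comm]
  have hanti' : AntitoneOn ψ (Icc ρ (ρ + m)) :=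
    hanti.mono (Icc_subset_Icc hρ.le (by linarith))
  have hup := hanti'.sum_le_integral
  have hlo := hanti'.integral_le_sum
  have hfirst0 : 0 ≤ ∫ u in (0)..ρ, ψ u :=
    integral_nonneg hρ.le fun u hu => h0 _ (hmem u ⟨hu.1, by linarith [hu.2, m.cast_nonneg (α := ℝ)]⟩)
  have hlast0 : 0 ≤ ∫ u in (ρ + m)..X, ψ u :=
    integral_nonneg (by linarith) fun u hu => h0 _ (hmem u ⟨by
      linarith [hu.1, m.cast_nonneg (α := ℝ)], hu.2⟩)
  have hfirst : ∫ u in (0)..ρ, ψ u ≤ M := by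
    have : ∫ u in (0)..ρ, ψ u ≤ ∫ u in (0)..ρ, M :=
      integral_mono_on hρ.le (hint _ _ le_rfl hρ.le (by linarith [m.cast_nonneg (α := ℝ)])) (by simp)
        fun u hu => hM _ (hmem u ⟨hu.1, by linarith [hu.2, m.cast_nonneg (α := ℝ)]⟩)
    rw [integral_const, smul_eq_mul, sub_zero] at this
    nlinarith [hS.le_one]
  have hpm : ρ + m ∈ Icc 0 X := ⟨by positivity, by linarith⟩
  have hlast : ∫ u in (ρ + m)..X, ψ u ≤ ψ (ρ + m) := by
    have : ∫ u in (ρ + m)..X, ψ u ≤ ∫ u in (ρ + m)..X, ψ (ρ + m) :=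
      integral_mono_on (by linarith) (hint _ _ (by positivity) (by linarith) le_rfl) (by simp)
        fun u hu => hanti hpm ⟨hpm.1.trans hu.1, hu.2⟩ hu.1
    rw [integral_const, smul_eq_mul] at this
    nlinarith [h0 _ (hmem _ hpm)]
  have hψρ : ψ (ρ + (0 : ℕ)) ≤ M := hM _ (hmem _ ⟨by positivity, by
    push_cast; linarith [m.cast_nonneg (α := ℝ)]⟩)
  unfold discrepancy
  rw [hIX, hsplit, hsum, abs_le]
  constructor
  · rw [Finset.sum_range_succ]; linarith
  · rw [Finset.sum_range_succ']; linarith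

/-- Assigning the upper bound `M` as value at `0` extends monotonicity from `(0, 1]` to `[0, 1]`. -/
lemma antitoneOn_update_zero {φ : ℝ → ℝ} {M : ℝ} (hφ : AntitoneOn φ (Ioc 0 1))
    (hM : ∀ t ∈ Ioc (0 : ℝ) 1, φ t ≤ M) : AntitoneOn (Function.update φ 0 M) (Icc 0 1) := by
  intro x hx y hy hxy
  rcases hx.1.eq_or_lt with rfl | hx0
  · rcases hy.1.eq_or_lt with rfl | hy0
    · exact le_rfl
    · rw [Function.update_self, Function.update_of_ne hy0.ne']
      exact hM y ⟨hy0, hy.2⟩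
  · rw [Function.update_of_ne hx0.ne', Function.update_of_ne (hx0.trans_le hxy).ne']
    exact hφ ⟨hx0, hx.2⟩ ⟨hx0.trans_le hxy, hy.2⟩ hxy

lemma intervalIntegrable_of_antitoneOn_Ioc {φ : ℝ → ℝ} {M : ℝ} (hφ : AntitoneOn φ (Ioc 0 1))
    (hM : ∀ t ∈ Ioc (0 : ℝ) 1, φ t ≤ M) : IntervalIntegrable φ volume 0 1 := by
  have h : IntervalIntegrable (Function.update φ 0 M) volume 0 1 :=
    AntitoneOn.intervalIntegrable (by
      rw [uIcc_of_le zero_le_one]; exact antitoneOn_update_zero hφ hM)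
  refine h.congr fun t ht => ?_
  rw [uIoc_of_le zero_le_one] at ht
  rw [Function.update_of_ne ht.1.ne']

namespace IsSampling

variable {X ρ : ℝ} {N : ℕ} {φ u v : ℝ → ℝ} {M U V : ℝ}

lemma abs_discrepancy_le_of_nonneg (hS : IsSampling X ρ N)
    (hφ : AntitoneOn φ (Ioc 0 1)) (h0 : ∀ t ∈ Ioc (0 : ℝ) 1, 0 ≤ φ t)
    (hM : ∀ t ∈ Ioc (0 : ℝ) 1, φ t ≤ M) : |discrepancy X ρ N φ| ≤ M := by
  have hM0 : 0 ≤ M := (h0 1 (by simp)).trans (hM 1 (by simp))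
  rw [hS.discrepancy_congr (ψ := Function.update φ 0 M) fun t ht => by
    rw [Function.update_of_ne ht.1.ne']]
  refine hS.abs_discrepancy_le_of_antitoneOn_Icc (antitoneOn_update_zero hφ hM) ?_ ?_
  · intro t ht
    rcases ht.1.eq_or_lt with rfl | ht0
    · simp [hM0]
    · rw [Function.update_of_ne ht0.ne']; exact h0 t ⟨ht0, ht.2⟩
  · intro t ht
    rcases ht.1.eq_or_lt with rfl | ht0
    · simp
    · rw [Function.update_of_ne ht0.ne']; exact hM t ⟨ht0, ht.2⟩

lemma abs_discrepancy_one_le (hS : IsSampling X ρ N) : |discrepancy X ρ N fun _ => 1| ≤ 1 :=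
  hS.abs_discrepancy_le_of_nonneg (fun _ _ _ _ _ => le_rfl) (fun _ _ => zero_le_one)
    fun _ _ => le_rfl

lemma abs_discrepancy_le (hS : IsSampling X ρ N) (hu : AntitoneOn u (Ioc 0 1))
    (hU : ∀ t ∈ Ioc (0 : ℝ) 1, |u t| ≤ U) : |discrepancy X ρ N u| ≤ 3 * U := by
  have hU0 : 0 ≤ U := (abs_nonneg _).trans (hU 1 (by simp))
  have h1 := hS.abs_discrepancy_le_of_nonneg (φ := fun t => u t + U) (M := 2 * U)
    (fun x hx y hy hxy => by have := hu hx hy hxy; simp only; linarith)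
    (fun t ht => by have := (abs_le.1 (hU t ht)).1; linarith)
    (fun t ht => by have := (abs_le.1 (hU t ht)).2; linarith)
  have hui := intervalIntegrable_of_antitoneOn_Ioc hu fun t ht => (abs_le.1 (hU t ht)).2
  have h2 := hS.abs_discrepancy_one_le
  have h3 : discrepancy X ρ N (fun t => u t + U) =
      discrepancy X ρ N u + U * discrepancy X ρ N fun _ => 1 := by
    rw [← discrepancy_const_mul, ← discrepancy_add hui (by simp)]; simp
  rw [h3] at h1
  have h4 : |U * discrepancy X ρ N fun _ => 1| ≤ U := by
    rw [abs_mul, abs_of_nonneg hU0]; nlinarith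
  rw [abs_le] at *
  constructor <;> linarith

/-- A product of two bounded decreasing functions has bounded discrepancy; after adding constants
the factors are nonnegative and the product is itself decreasing. -/
lemma abs_discrepancy_mul_le (hS : IsSampling X ρ N) (hu : AntitoneOn u (Ioc 0 1))
    (hU : ∀ t ∈ Ioc (0 : ℝ) 1, |u t| ≤ U) (hv : AntitoneOn v (Ioc 0 1))
    (hV : ∀ t ∈ Ioc (0 : ℝ) 1, |v t| ≤ V) :
    IntervalIntegrable (fun t => u t * v t) volume 0 1 ∧
      |discrepancy X ρ N (fun t => u t * v t)| ≤ 11 * (U * V) := by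
  have hU0 : 0 ≤ U := (abs_nonneg _).trans (hU 1 (by simp))
  have hV0 : 0 ≤ V := (abs_nonneg _).trans (hV 1 (by simp))
  have hub : ∀ t ∈ Ioc (0 : ℝ) 1, 0 ≤ u t + U ∧ u t + U ≤ 2 * U := fun t ht => by
    have := abs_le.1 (hU t ht); constructor <;> linarith
  have hvb : ∀ t ∈ Ioc (0 : ℝ) 1, 0 ≤ v t + V ∧ v t + V ≤ 2 * V := fun t ht => by
    have := abs_le.1 (hV t ht); constructor <;> linarith
  have hanti : AntitoneOn (fun t => (u t + U) * (v t + V)) (Ioc 0 1) := fun x hx y hy hxy =>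
    mul_le_mul (by linarith [hu hx hy hxy]) (by linarith [hv hx hy hxy]) (hvb y hy).1 (hub x hx).1
  have hbd : ∀ t ∈ Ioc (0 : ℝ) 1, (u t + U) * (v t + V) ≤ 2 * U * (2 * V) := fun t ht =>
    mul_le_mul (hub t ht).2 (hvb t ht).2 (hvb t ht).1 (by positivity)
  have hui := intervalIntegrable_of_antitoneOn_Ioc hu fun t ht => (abs_le.1 (hU t ht)).2
  have hvi := intervalIntegrable_of_antitoneOn_Ioc hv fun t ht => (abs_le.1 (hV t ht)).2
  have huvi := intervalIntegrable_of_antitoneOn_Ioc hanti hbd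
  have e : (fun t => u t * v t) = fun t => (u t + U) * (v t + V) +
      (-U * v t + (-V * u t + -(U * V) * 1)) := by ext t; ring
  have hi2 : IntervalIntegrable (fun t => -V * u t + -(U * V) * 1) volume 0 1 :=
    (hui.const_mul _).add (by simp)
  have hi1 : IntervalIntegrable (fun t => -U * v t + (-V * u t + -(U * V) * 1)) volume 0 1 :=
    (hvi.const_mul _).add hi2
  rw [e]
  refine ⟨huvi.add hi1, ?_⟩
  rw [discrepancy_add huvi hi1, discrepancy_add (hvi.const_mul _) hi2,
    discrepancy_add (hui.const_mul _) (by simp), discrepancy_const_mul, discrepancy_const_mul,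
    discrepancy_const_mul]
  have h1 := hS.abs_discrepancy_le_of_nonneg hanti
    (fun t ht => mul_nonneg (hub t ht).1 (hvb t ht).1) hbd
  have h2 : |-U * discrepancy X ρ N v| ≤ U * (3 * V) := by
    rw [abs_mul, abs_neg, abs_of_nonneg hU0]
    exact mul_le_mul_of_nonneg_left (hS.abs_discrepancy_le hv hV) hU0
  have h3 : |-V * discrepancy X ρ N u| ≤ V * (3 * U) := by
    rw [abs_mul, abs_neg, abs_of_nonneg hV0]
    exact mul_le_mul_of_nonneg_left (hS.abs_discrepancy_le hu hU) hV0
  have h4 : |-(U * V) * discrepancy X ρ N fun _ => 1| ≤ U * V * 1 := by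
    rw [abs_mul, abs_neg, abs_of_nonneg (mul_nonneg hU0 hV0)]
    exact mul_le_mul_of_nonneg_left hS.abs_discrepancy_one_le (mul_nonneg hU0 hV0)
  refine (abs_add_le _ _).trans ?_
  have h5 := abs_add_le (-U * discrepancy X ρ N v)
    (-V * discrepancy X ρ N u + -(U * V) * discrepancy X ρ N fun _ => 1)
  have h6 := abs_add_le (-V * discrepancy X ρ N u) (-(U * V) * discrepancy X ρ N fun _ => 1)
  linarith

/-- The Hurwitz zeta value `ζ(1/2, ρ)` is the second-order term in sampling `t ^ (-1/2)` along a
progression with offset `ρ`. -/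
lemma abs_discrepancy_one_div_sqrt_sub_le (hS : IsSampling X ρ N) :
    |(discrepancy X ρ N fun t => 1 / √t) - √X * hurwitzHalf ρ| ≤ 2 := by
  have hX := hS.X_pos
  have hsX : 0 < √X := Real.sqrt_pos.2 hX
  have hlt : X < ρ + N := by linarith [hS.lt]
  have h1 := abs_sum_sub_sub_hurwitzHalf_le hS.pos N
  have h2 := two_mul_sqrt_succ_sub_le hX
  have h3 : √(ρ + N) ≤ √(X + 1) := Real.sqrt_le_sqrt (by linarith [hS.le])
  have h4 : √X ≤ √(ρ + N) := Real.sqrt_le_sqrt hlt.le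
  have h5 : 1 / √(ρ + N) ≤ 1 / √X := by gcongr
  have hs : √X * √X = X := Real.mul_self_sqrt hX.le
  have h6 : |∑ n ∈ Finset.range N, 1 / √(ρ + n) - 2 * √X - hurwitzHalf ρ| ≤ 2 / √X := by
    rw [abs_le] at h1 ⊢
    rw [show 2 / √X = 1 / √X + 1 / √X by ring]
    constructor <;> linarith
  have h7 : (discrepancy X ρ N fun t => 1 / √t) - √X * hurwitzHalf ρ =
      √X * (∑ n ∈ Finset.range N, 1 / √(ρ + n) - 2 * √X - hurwitzHalf ρ) := by
    unfold discrepancy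
    rw [integral_one_div_sqrt, mul_sub, mul_sub, Finset.mul_sum]
    have : ∀ n : ℕ, 1 / √((n + ρ) / X) = √X * (1 / √(ρ + n)) := by
      intro n
      have := hS.pos
      rw [Real.sqrt_div (by positivity), one_div_div, mul_one_div, add_comm]
    simp only [this]
    linear_combination 2 * hs
  rw [h7, abs_mul, abs_of_pos hsX]
  calc √X * _ ≤ √X * (2 / √X) := by gcongr
    _ = 2 := by field_simp

/-- For a convex decreasing `f` the singular function `f(t) / √t` has discrepancy
`√X f(0) ζ(1/2, ρ)` up to a bounded error: the difference `(f(0) - f(t)) / √t` is the product of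
the slope `(f(0) - f(t)) / t`, which is monotone by convexity, and the monotone function `√t`. -/
lemma abs_discrepancy_one_div_sqrt_mul_sub_le (hS : IsSampling X ρ N) {f : ℝ → ℝ}
    (hconv : ConvexOn ℝ (Icc 0 1) f) (hanti : AntitoneOn f (Icc 0 1))
    (hM : ∀ t ∈ Ioc (0 : ℝ) 1, f 0 - f t ≤ M * t) :
    |(discrepancy X ρ N fun t => 1 / √t * f t) - √X * f 0 * hurwitzHalf ρ| ≤
      2 * |f 0| + 11 * M := by
  have h0 : (0 : ℝ) ∈ Icc (0 : ℝ) 1 := by simp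
  have hs : AntitoneOn (fun t => (f 0 - f t) / t) (Ioc 0 1) := by
    intro x hx y hy hxy
    have := hconv.secant_mono h0 (Ioc_subset_Icc_self hx) (Ioc_subset_Icc_self hy) hx.1.ne'
      hy.1.ne' hxy
    simp only [sub_zero] at this
    have e : ∀ t, (f 0 - f t) / t = -((f t - f 0) / t) := fun t => by ring
    simp only [e]; linarith
  have hsb : ∀ t ∈ Ioc (0 : ℝ) 1, |(f 0 - f t) / t| ≤ M := by
    intro t ht
    have h1 : 0 ≤ f 0 - f t := by linarith [hanti h0 (Ioc_subset_Icc_self ht) ht.1.le]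
    rw [abs_of_nonneg (div_nonneg h1 ht.1.le), div_le_iff₀ ht.1]
    exact hM t ht
  obtain ⟨hi, hb⟩ := hS.abs_discrepancy_mul_le hs hsb (v := fun t => -√t) (V := 1)
    (fun x _ y _ hxy => neg_le_neg (Real.sqrt_le_sqrt hxy)) (fun t ht => by
      rw [abs_neg, abs_of_nonneg (Real.sqrt_nonneg t)]; exact Real.sqrt_le_one.2 ht.2)
  rw [hS.discrepancy_congr (ψ := fun t => f 0 * (1 / √t) + (f 0 - f t) / t * -√t) fun t ht => by
      have : √t * √t = t := Real.mul_self_sqrt ht.1.le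
      have h2 : 0 < √t := Real.sqrt_pos.2 ht.1
      have h3 : √t / t = 1 / √t := by
        rw [div_eq_div_iff ht.1.ne' h2.ne']; linarith
      linear_combination (-(f t) + f 0) * h3,
    discrepancy_add (intervalIntegrable_one_div_sqrt.const_mul _) hi, discrepancy_const_mul]
  have h1 := hS.abs_discrepancy_one_div_sqrt_sub_le
  have h2 : |f 0 * ((discrepancy X ρ N fun t => 1 / √t) - √X * hurwitzHalf ρ)| ≤ |f 0| * 2 := by
    rw [abs_mul]; gcongr
  have e : f 0 * (discrepancy X ρ N fun t => 1 / √t) +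
      (discrepancy X ρ N fun t => (f 0 - f t) / t * -√t) - √X * f 0 * hurwitzHalf ρ =
      f 0 * ((discrepancy X ρ N fun t => 1 / √t) - √X * hurwitzHalf ρ) +
      (discrepancy X ρ N fun t => (f 0 - f t) / t * -√t) := by ring
  rw [e]
  refine (abs_add_le _ _).trans ?_
  rw [mul_one] at hb
  linarith

lemma abs_sum_one_div_sub_le (hS : IsSampling X 1 N) :
    |∑ n ∈ Finset.range N, 1 / (((n : ℝ) + 1) / X) - X * (Real.log X + Real.eulerMascheroniConstant)|
      ≤ 2 := by
  have hX := hS.X_pos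
  obtain ⟨m, hm⟩ : ∃ m, N = m + 1 := ⟨N - 1, by have := hS.N_pos; omega⟩
  have hN : (1 : ℝ) ≤ N := by exact_mod_cast hS.N_pos
  have hN0 : (0 : ℝ) < N := by linarith
  have h1 := Real.eulerMascheroniSeq_lt_eulerMascheroniConstant N
  have h2 := Real.eulerMascheroniConstant_lt_eulerMascheroniSeq' N
  unfold Real.eulerMascheroniSeq at h1
  rw [Real.eulerMascheroniSeq', if_neg hS.N_pos.ne'] at h2
  have h3 : Real.log N ≤ Real.log X := Real.log_le_log hN0 (by linarith [hS.le])
  have h4 : Real.log X ≤ Real.log (N + 1) := Real.log_le_log hX (by linarith [hS.lt])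
  have h5 : Real.log (N + 1) - Real.log N ≤ 1 / N := by
    rw [← Real.log_div (by linarith) hN0.ne']
    have := Real.log_le_sub_one_of_pos (x := ((N : ℝ) + 1) / N) (by positivity)
    have e : ((N : ℝ) + 1) / N - 1 = 1 / N := by field_simp; ring
    rwa [e] at this
  have h6 : 1 / (N : ℝ) ≤ 2 / X := by
    rw [div_le_div_iff₀ hN0 hX]; linarith [hS.lt]
  have hH : ∑ n ∈ Finset.range N, 1 / (((n : ℝ) + 1) / X) = X * (harmonic N : ℝ) := by
    rw [harmonic]; push_cast
    rw [Finset.mul_sum]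
    exact Finset.sum_congr rfl fun n _ => by rw [one_div_div, div_eq_mul_inv]
  rw [hH, ← mul_sub, abs_mul, abs_of_pos hX]
  calc X * |(harmonic N : ℝ) - (Real.log X + Real.eulerMascheroniConstant)| ≤ X * (2 / X) := by
        gcongr; rw [abs_le]; constructor <;> linarith
    _ = 2 := by field_simp

end IsSampling

/-! ### Sums of `ζ(1/2, (j + t) / h) ζ(1/2, t)` over a progression -/

lemma antitoneOn_hurwitzHalf_add_one : AntitoneOn (fun t => hurwitzHalf (t + 1)) (Icc 0 1) :=
  fun x hx y hy hxy => antitoneOn_hurwitzHalf (mem_Ioi.2 (by linarith [hx.1]))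
    (mem_Ioi.2 (by linarith [hy.1])) (by linarith)

lemma ConvexOn.comp_affine_Icc {f : ℝ → ℝ} (hf : ConvexOn ℝ (Ioi 0) f) {a b : ℝ} (ha : 0 ≤ a)
    (hb : 0 < b) : ConvexOn ℝ (Icc 0 1) fun t => f (a * t + b) := by
  refine ⟨convex_Icc 0 1, fun x hx y hy c d hc hd hcd => ?_⟩
  have h := hf.2 (x := a * x + b) (mem_Ioi.2 (add_pos_of_nonneg_of_pos (mul_nonneg ha hx.1) hb)) (y := a * y + b)
    (mem_Ioi.2 (add_pos_of_nonneg_of_pos (mul_nonneg ha hy.1) hb)) hc hd hcd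
  have e : a * (c • x + d • y) + b = c • (a * x + b) + d • (a * y + b) := by
    simp only [smul_eq_mul]; linear_combination -b * hcd
  simp only [e]
  exact h

/-- For `0 < j < h` the factor `ζ(1/2, (j + t) / h)` is regular on `[0, 1]`, and only the
singularity of `ζ(1/2, t)` at `t = 0` contributes beyond the integral. The error `√(h / j)` has sum
`O(h)` over `j`. -/
lemma IsSampling.abs_sum_hurwitzHalf_mul_sub_le {X ρ : ℝ} {N : ℕ} (hS : IsSampling X ρ N)
    {h j : ℕ} (hj : 0 < j) (hjh : j < h) :
    IntervalIntegrable (fun t => hurwitzHalf ((j + t) / h) * hurwitzHalf t) volume 0 1 ∧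
    |∑ n ∈ Finset.range N, hurwitzHalf ((j + (n + ρ) / X) / h) * hurwitzHalf ((n + ρ) / X) -
      X * (∫ t in (0)..1, hurwitzHalf ((j + t) / h) * hurwitzHalf t) -
      √X * hurwitzHalf (j / h) * hurwitzHalf ρ| ≤ 180 * √(h / j) := by
  have hh0 : (0 : ℝ) < h := by exact_mod_cast hj.trans hjh
  have hj0 : (0 : ℝ) < j := by exact_mod_cast hj
  have hj1 : (1 : ℝ) ≤ j := by exact_mod_cast hj
  have hjh1 : (j : ℝ) + 1 ≤ h := by exact_mod_cast hjh
  set f : ℝ → ℝ := fun t => hurwitzHalf ((j + t) / h) with hf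
  have hf_eq : f = fun t => hurwitzHalf (1 / h * t + j / h) := by
    ext t; simp only [hf]; congr 1; ring
  have hpos : ∀ t ∈ Icc (0 : ℝ) 1, 0 < (j + t) / h := fun t ht => by
    have := ht.1; positivity
  have hconv : ConvexOn ℝ (Icc 0 1) f := by
    rw [hf_eq]; exact convexOn_hurwitzHalf.comp_affine_Icc (by positivity) (by positivity)
  have hanti : AntitoneOn f (Icc 0 1) := fun x hx y hy hxy =>
    antitoneOn_hurwitzHalf (hpos x hx) (hpos y hy) (by gcongr)
  have hcont : ContinuousOn f (Icc 0 1) :=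
    continuousOn_hurwitzHalf.comp (by fun_prop) fun t ht => hpos t ht
  have hsq : √((h : ℝ) / j) = 1 / √((j : ℝ) / h) := by
    rw [← Real.sqrt_one, ← Real.sqrt_div zero_le_one, one_div_div]
  have hfb : ∀ t ∈ Icc (0 : ℝ) 1, |f t| ≤ 2 * √(h / j) := fun t ht => by
    refine (abs_hurwitzHalf_le (hpos t ht) ?_).trans ?_
    · rw [div_le_one hh0]; linarith [ht.2]
    · rw [hsq, mul_one_div]
      have : (j : ℝ) / h ≤ (j + t) / h := by gcongr; linarith [ht.1]
      gcongr
  have hslope : ∀ t ∈ Ioc (0 : ℝ) 1, f 0 - f t ≤ 10 * √(h / j) * t := fun t ht => by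
    have h1 := hurwitzHalf_sub_le (x := j / h) (y := (j + t) / h) (by positivity)
      (by rw [div_le_one hh0]; linarith) (by gcongr; linarith [ht.1])
    have e : (j + t) / h - (j : ℝ) / h = t / h := by ring
    rw [e] at h1
    simp only [hf, add_zero]
    refine h1.trans ?_
    have e2 : 10 / ((j : ℝ) / h * √(j / h)) * (t / h) = 10 * (1 / √((j : ℝ) / h)) * t * (1 / j) := by
      have : 0 < √((j : ℝ) / h) := Real.sqrt_pos.2 (by positivity)
      field_simp
    rw [e2, ← hsq]
    have h3 : 1 / (j : ℝ) ≤ 1 := by rw [div_le_one hj0]; exact hj1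
    have h4 : 0 ≤ 10 * √((h : ℝ) / j) * t := by have := ht.1; positivity
    nlinarith
  have h1 := hS.abs_discrepancy_one_div_sqrt_mul_sub_le hconv hanti hslope
  obtain ⟨hi2, h2⟩ := hS.abs_discrepancy_mul_le (hanti.mono Ioc_subset_Icc_self)
    (fun t ht => hfb t (Ioc_subset_Icc_self ht)) (v := fun t => hurwitzHalf (t + 1)) (V := 3)
    (antitoneOn_hurwitzHalf_add_one.mono Ioc_subset_Icc_self)
    (fun t ht => abs_hurwitzHalf_le_three (by linarith [ht.1]) (by linarith [ht.2]))
  have hi1 := intervalIntegrable_one_div_sqrt_mul hcont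
  have hcongr : ∀ t ∈ Ioc (0 : ℝ) 1, f t * hurwitzHalf t =
      1 / √t * f t + f t * hurwitzHalf (t + 1) := fun t ht => by
    rw [hurwitzHalf_eq_add ht.1]; ring
  have hd := hS.discrepancy_congr hcongr
  rw [discrepancy_add hi1 hi2] at hd
  refine ⟨(hi1.add hi2).congr fun t ht => ?_, ?_⟩
  · rw [uIoc_of_le zero_le_one] at ht
    exact (hcongr t ht).symm
  · change |discrepancy X ρ N (fun t => f t * hurwitzHalf t) - _| ≤ _
    have hf0 : hurwitzHalf (j / h) = f 0 := by simp [hf]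
    rw [hd, hf0]
    have h3 := hfb 0 (by simp)
    rw [abs_le] at h1 h2 ⊢
    constructor <;> linarith

/-- The case `j = 0`, where both factors are singular at `t = 0`: the product behaves like `√h / t`,
which produces the logarithm and Euler's constant. -/
lemma IsSampling.abs_sum_hurwitzHalf_div_mul_sub_le {X : ℝ} {N : ℕ} (hS : IsSampling X 1 N)
    {h : ℕ} (hh : 1 ≤ h) :
    IntervalIntegrable (fun t => hurwitzHalf (t / h) * hurwitzHalf t - √h / t) volume 0 1 ∧
    |∑ n ∈ Finset.range N, hurwitzHalf ((n + 1) / X / h) * hurwitzHalf ((n + 1) / X) -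
      X * √h * (Real.log X + Real.eulerMascheroniConstant) -
      X * (∫ t in (0)..1, (hurwitzHalf (t / h) * hurwitzHalf t - √h / t)) -
      √X * (√h + 1) * hurwitzHalf 1 ^ 2| ≤ 333 * √h := by
  have hh1 : (1 : ℝ) ≤ h := by exact_mod_cast hh
  have hh0 : (0 : ℝ) < h := by linarith
  have hs1 : 1 ≤ √(h : ℝ) := Real.one_le_sqrt.2 hh1
  set G : ℝ → ℝ := fun t => hurwitzHalf (t + 1) with hG
  set H : ℝ → ℝ := fun t => hurwitzHalf (t / h + 1) with hH
  set f : ℝ → ℝ := fun t => √h * G t + H t with hf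
  have hth : ∀ t ∈ Icc (0 : ℝ) 1, 0 ≤ t / h ∧ t / h ≤ 1 := fun t ht =>
    ⟨div_nonneg ht.1 hh0.le, (div_le_one hh0).2 (ht.2.trans hh1)⟩
  have hHc : ContinuousOn H (Icc 0 1) := continuousOn_hurwitzHalf.comp (by fun_prop)
    fun t ht => mem_Ioi.2 (by linarith [(hth t ht).1])
  have hHa : AntitoneOn H (Icc 0 1) := fun x hx y hy hxy =>
    antitoneOn_hurwitzHalf (mem_Ioi.2 (by linarith [(hth x hx).1]))
      (mem_Ioi.2 (by linarith [(hth y hy).1])) (by gcongr)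
  have hGa : AntitoneOn G (Icc 0 1) := antitoneOn_hurwitzHalf_add_one
  have hGv : ConvexOn ℝ (Icc 0 1) G := by
    have := convexOn_hurwitzHalf.comp_affine_Icc (a := 1) (b := 1) (by norm_num) (by norm_num)
    simpa only [one_mul] using this
  have hHv : ConvexOn ℝ (Icc 0 1) H := by
    have := convexOn_hurwitzHalf.comp_affine_Icc (a := 1 / h) (b := 1) (by positivity) (by norm_num)
    simpa only [one_div_mul_eq_div] using this
  have hGb : ∀ t ∈ Icc (0 : ℝ) 1, |G t| ≤ 3 := fun t ht =>
    abs_hurwitzHalf_le_three (by linarith [ht.1]) (by linarith [ht.2])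
  have hHb : ∀ t ∈ Icc (0 : ℝ) 1, |H t| ≤ 3 := fun t ht =>
    abs_hurwitzHalf_le_three (by linarith [(hth t ht).1]) (by linarith [(hth t ht).2])
  have hconv : ConvexOn ℝ (Icc 0 1) f := (hGv.smul (Real.sqrt_nonneg h)).add hHv
  have hanti : AntitoneOn f (Icc 0 1) := fun x hx y hy hxy =>
    add_le_add (mul_le_mul_of_nonneg_left (hGa hx hy hxy) (Real.sqrt_nonneg _)) (hHa hx hy hxy)
  have hcont : ContinuousOn f (Icc 0 1) :=
    (continuousOn_const.mul continuousOn_hurwitzHalf_add_one).add hHc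
  have hone : ∀ t : ℝ, 0 ≤ t → hurwitzHalf 1 - hurwitzHalf (t + 1) ≤ 10 * t := fun t ht => by
    have := hurwitzHalf_sub_le (x := 1) (y := t + 1) one_pos le_rfl (by linarith)
    simpa using this
  have hslope : ∀ t ∈ Ioc (0 : ℝ) 1, f 0 - f t ≤ 20 * √h * t := fun t ht => by
    have h1 := hone t ht.1.le
    have h2 := hone (t / h) (hth t (Ioc_subset_Icc_self ht)).1
    have h3 : t / h ≤ t := div_le_self ht.1.le hh1
    have h4 := mul_le_mul_of_nonneg_left h1 (Real.sqrt_nonneg (h : ℝ))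
    have h5 : t ≤ √h * t := le_mul_of_one_le_left ht.1.le hs1
    simp only [hf, hG, hH, zero_add, zero_div]
    linarith
  have h1 := hS.abs_discrepancy_one_div_sqrt_mul_sub_le hconv hanti hslope
  obtain ⟨hi2, h2⟩ := hS.abs_discrepancy_mul_le (hHa.mono Ioc_subset_Icc_self)
    (fun t ht => hHb t (Ioc_subset_Icc_self ht))
    (hGa.mono Ioc_subset_Icc_self) (fun t ht => hGb t (Ioc_subset_Icc_self ht))
  have hi1 := intervalIntegrable_one_div_sqrt_mul hcont
  have hcongr : ∀ t ∈ Ioc (0 : ℝ) 1, hurwitzHalf (t / h) * hurwitzHalf t - √h / t =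
      1 / √t * f t + H t * G t := fun t ht => by
    have ht0 := ht.1
    have e : 1 / t = (1 / √t) ^ 2 := by rw [div_pow, Real.sq_sqrt ht.1.le, one_pow]
    have e2 : √(h : ℝ) / t = √h * (1 / √t) ^ 2 := by rw [← e]; ring
    have e3 : 1 / √(t / h) = √h * (1 / √t) := by
      rw [Real.sqrt_div ht0.le, one_div_div]; ring
    rw [hurwitzHalf_eq_add ht0, hurwitzHalf_eq_add (x := t / h) (by positivity), e2, e3]
    simp only [hf, hG, hH]; ring
  have hd := hS.discrepancy_congr hcongr
  rw [discrepancy_add hi1 hi2] at hd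
  refine ⟨(hi1.add hi2).congr fun t ht => ?_, ?_⟩
  · rw [uIoc_of_le zero_le_one] at ht
    exact (hcongr t ht).symm
  · have h3 := hS.abs_sum_one_div_sub_le
    have h4 : |√(h : ℝ) * (∑ n ∈ Finset.range N, 1 / (((n : ℝ) + 1) / X) -
        X * (Real.log X + Real.eulerMascheroniConstant))| ≤ √h * 2 := by
      rw [abs_mul, abs_of_nonneg (Real.sqrt_nonneg _)]; gcongr
    have hf0 : f 0 = (√h + 1) * hurwitzHalf 1 := by simp [hf, hG, hH]; ring
    have hf0b : |f 0| ≤ 6 * √h := by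
      rw [hf0, abs_mul, abs_of_nonneg (by positivity)]
      nlinarith [abs_hurwitzHalf_le_three (x := 1) le_rfl (by norm_num)]
    have hexp : discrepancy X 1 N (fun t => hurwitzHalf (t / h) * hurwitzHalf t - √h / t) =
        ∑ n ∈ Finset.range N, hurwitzHalf ((n + 1) / X / h) * hurwitzHalf ((n + 1) / X) -
        √h * ∑ n ∈ Finset.range N, 1 / (((n : ℝ) + 1) / X) -
        X * (∫ t in (0)..1, (hurwitzHalf (t / h) * hurwitzHalf t - √h / t)) := by
      unfold discrepancy
      rw [Finset.sum_sub_distrib, Finset.mul_sum]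
      simp only [mul_one_div]
    rw [hexp] at hd
    rw [hf0] at h1 hf0b
    have e : √X * ((√h + 1) * hurwitzHalf 1) * hurwitzHalf 1 =
      √X * (√h + 1) * hurwitzHalf 1 ^ 2 := by ring
    rw [e] at h1
    rw [abs_le] at h1 h2 h4 ⊢
    constructor <;> nlinarith

/-! ### Reciprocity for Dedekind-type sums of Hurwitz zeta values -/

/-- The function `b ↦ ζ(1/2, {b / q})` on `ZMod q`, with the fractional part taken in `(0, 1]`, so
that its value at `0` is `ζ(1/2, 1) = ζ(1/2)`. -/
noncomputable def hurwitzHalfMod (q : ℕ) (b : ZMod q) : ℝ :=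
  if b = 0 then hurwitzHalf 1 else hurwitzHalf (b.val / q)

/-- The Dedekind-type sum `∑_{b mod q} ζ(1/2, {b / q}) ζ(1/2, {a b / q})`, including `b = 0`. -/
noncomputable def hurwitzHalfSum (q : ℕ) [NeZero q] (a : ZMod q) : ℝ :=
  ∑ b : ZMod q, hurwitzHalfMod q b * hurwitzHalfMod q (a * b)

lemma hurwitzHalfMod_natCast {q m : ℕ} (hm : 1 ≤ m) (hmq : m ≤ q) :
    hurwitzHalfMod q (m : ZMod q) = hurwitzHalf (m / q) := by
  unfold hurwitzHalfMod
  rcases hmq.eq_or_lt with rfl | hlt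
  · have : (m : ℝ) ≠ 0 := by positivity
    rw [ZMod.natCast_self, if_pos rfl, div_self this]
  · rw [if_neg, ZMod.val_natCast_of_lt hlt]
    rw [ZMod.natCast_eq_zero_iff]
    exact fun h => absurd (Nat.le_of_dvd hm h) (by omega)

lemma ZMod.sum_eq_sum_range {M : Type*} [AddCommMonoid M] (q : ℕ) [NeZero q] (f : ZMod q → M) :
    ∑ b, f b = ∑ i ∈ Finset.range q, f i := by
  refine Finset.sum_nbij' (fun b => b.val) (fun i => (i : ZMod q)) ?_ ?_ ?_ ?_ ?_
  · intro b _; exact Finset.mem_range.2 b.val_lt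
  · simp
  · intro b _; simp
  · intro i hi; exact ZMod.val_natCast_of_lt (Finset.mem_range.1 hi)
  · intro b _; simp

lemma sum_range_eq_sum_blocks {M : Type*} [AddCommMonoid M] {B : ℕ → ℕ} (hB : Monotone B)
    (hB0 : B 0 = 0) (g : ℕ → M) (h : ℕ) :
    ∑ i ∈ Finset.range (B h), g i =
      ∑ j ∈ Finset.range h, ∑ n ∈ Finset.range (B (j + 1) - B j), g (B j + n) := by
  induction h with
  | zero => simp [hB0]
  | succ h ih =>
    rw [Finset.sum_range_succ, ← ih, ← Finset.sum_range_add, Nat.add_sub_cancel' (hB h.le_succ)]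

/-- The residues `1 ≤ b ≤ p` split into `h` blocks according to the `j` with
`j p < h b ≤ (j + 1) p`; the `j`-th block starts after `⌊j p / h⌋`. -/
lemma hurwitzHalfSum_eq_sum_blocks {p h : ℕ} [NeZero p] (hh : 0 < h) :
    hurwitzHalfSum p (h : ZMod p) = ∑ j ∈ Finset.range h,
      ∑ n ∈ Finset.range ((j + 1) * p / h - j * p / h),
        hurwitzHalfMod p ((j * p / h + n + 1 : ℕ) : ZMod p) *
          hurwitzHalfMod p (h * (j * p / h + n + 1 : ℕ) : ZMod p) := by
  have h1 := sum_range_eq_sum_blocks (B := fun j => j * p / h)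
    (fun a b hab => Nat.div_le_div_right (Nat.mul_le_mul_right p hab)) (by simp)
    (fun i => hurwitzHalfMod p ((i + 1 : ℕ) : ZMod p) *
      hurwitzHalfMod p (h * (i + 1 : ℕ) : ZMod p)) h
  simp only [Nat.mul_div_cancel_left p hh] at h1
  rw [← h1, hurwitzHalfSum, ← Equiv.sum_comp (Equiv.addRight (1 : ZMod p)), ZMod.sum_eq_sum_range]
  simp

/-- Within the `j`-th block the numbers `h b / p - j` form a progression of step `h / p` in
`(0, 1]`, with offset determined by the residue `- j p` modulo `h`. -/
lemma isSampling_block {p h : ℕ} (hh : 0 < h) (hhp : h ≤ p) (j : ℕ) :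
    IsSampling ((p : ℝ) / h) ((h - (j * p % h : ℕ)) / h) ((j + 1) * p / h - j * p / h) := by
  have hh0 : (0 : ℝ) < h := by exact_mod_cast hh
  have hB : j * p / h ≤ (j + 1) * p / h :=
    Nat.div_le_div_right (Nat.mul_le_mul_right p j.le_succ)
  have h1 : ((j * p % h : ℕ) : ℝ) < h := by exact_mod_cast Nat.mod_lt _ hh
  have h2 : (0 : ℝ) ≤ (j * p % h : ℕ) := by positivity
  have h3 : (h : ℝ) * (j * p / h : ℕ) + (j * p % h : ℕ) = j * p := by
    exact_mod_cast Nat.div_add_mod (j * p) h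
  have h4 : (h : ℝ) * ((j + 1) * p / h : ℕ) + ((j + 1) * p % h : ℕ) = (j + 1) * p := by
    exact_mod_cast Nat.div_add_mod ((j + 1) * p) h
  have h5 : (((j + 1) * p % h : ℕ) : ℝ) < h := by exact_mod_cast Nat.mod_lt _ hh
  have h6 : (0 : ℝ) ≤ ((j + 1) * p % h : ℕ) := by positivity
  refine ⟨?_, ?_, ?_, ?_, ?_⟩
  · rw [one_le_div hh0]; exact_mod_cast hhp
  · exact div_pos (by linarith) hh0
  · rw [div_le_one hh0]; linarith
  · rw [Nat.cast_sub hB, ← sub_nonneg]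
    have : (p : ℝ) / h - (((((j + 1) * p / h : ℕ) : ℝ) - (j * p / h : ℕ)) - 1 +
        (h - (j * p % h : ℕ)) / h) = ((j + 1) * p % h : ℕ) / h := by
      field_simp; linarith
    rw [this]; positivity
  · rw [Nat.cast_sub hB, ← sub_pos]
    have : ((((j + 1) * p / h : ℕ) : ℝ) - (j * p / h : ℕ)) +
        (h - (j * p % h : ℕ)) / h - (p : ℝ) / h = (h - ((j + 1) * p % h : ℕ)) / h := by
      field_simp; linarith
    rw [this]; exact div_pos (by linarith) hh0

lemma block_term_eq {p h : ℕ} (hh : 0 < h) (hp : 0 < p) {j n : ℕ} (hjh : j < h)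
    (hn : n < (j + 1) * p / h - j * p / h) :
    hurwitzHalfMod p ((j * p / h + n + 1 : ℕ) : ZMod p) *
      hurwitzHalfMod p (h * (j * p / h + n + 1 : ℕ) : ZMod p) =
    hurwitzHalf ((j + (n + (h - (j * p % h : ℕ)) / h) / ((p : ℝ) / h)) / h) *
      hurwitzHalf ((n + (h - (j * p % h : ℕ)) / h) / ((p : ℝ) / h)) := by
  have hh0 : (0 : ℝ) < h := by exact_mod_cast hh
  have hp0 : (0 : ℝ) < p := by exact_mod_cast hp
  set b := j * p / h + n + 1 with hb
  have h1 := Nat.div_add_mod (j * p) h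
  have h2 := Nat.mod_lt (j * p) hh
  have hble : b ≤ (j + 1) * p / h := by omega
  have hb2 : b * h ≤ (j + 1) * p := (Nat.le_div_iff_mul_le hh).1 hble
  have hb1 : j * p < h * b := by
    rw [hb, mul_add, mul_add]; nlinarith
  have hbp : b ≤ p := by
    have : b * h ≤ h * p := hb2.trans (Nat.mul_le_mul_right p hjh)
    rw [mul_comm] at this
    exact Nat.le_of_mul_le_mul_left this hh
  have ht : ((n : ℝ) + (h - (j * p % h : ℕ)) / h) / ((p : ℝ) / h) = ((h * b - j * p : ℕ) : ℝ) / p := by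
    have h1' : (h : ℝ) * (j * p / h : ℕ) + (j * p % h : ℕ) = j * p := by exact_mod_cast h1
    rw [Nat.cast_sub hb1.le, hb]
    push_cast
    field_simp
    linarith
  have ht2 : ((j : ℝ) + ((h * b - j * p : ℕ) : ℝ) / p) / h = b / p := by
    rw [Nat.cast_sub hb1.le]; push_cast; field_simp; ring
  rw [ht, ht2, hurwitzHalfMod_natCast (Nat.succ_pos _) hbp]
  congr 1
  rw [← hurwitzHalfMod_natCast (q := p) (m := h * b - j * p) (by omega) (by
    have : (j + 1) * p = j * p + p := by ring
    rw [mul_comm h b]; omega)]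
  congr 1
  rw [Nat.cast_sub hb1.le]; push_cast; simp

lemma hurwitzHalfMod_neg_mul {p h : ℕ} (hh : 0 < h) (j : ℕ) :
    hurwitzHalfMod h (-(p : ZMod h) * j) = hurwitzHalf ((h - (j * p % h : ℕ)) / h) := by
  have h1 := Nat.mod_lt (j * p) hh
  have : (-(p : ZMod h) * j) = ((h - j * p % h : ℕ) : ZMod h) := by
    rw [Nat.cast_sub h1.le, ZMod.natCast_mod]; push_cast; simp [mul_comm]
  rw [this, hurwitzHalfMod_natCast (by omega) (by omega), Nat.cast_sub h1.le]

lemma sum_one_div_sqrt_succ_le (m : ℕ) :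
    ∑ j ∈ Finset.range m, 1 / √((j + 1 : ℕ) : ℝ) ≤ 2 * √m := by
  induction m with
  | zero => simp
  | succ m ih =>
    have := le_two_mul_sqrt_succ_sub (a := m) m.cast_nonneg
    rw [Finset.sum_range_succ]; push_cast at *; linarith

/-- By the distribution relation the integrals over the blocks add up to `√h` times the regularised
mean square. -/
lemma integral_block_sum {m : ℕ}
    (h0 : IntervalIntegrable (fun t => hurwitzHalf (t / (m + 1 : ℕ)) * hurwitzHalf t -
      √((m + 1 : ℕ) : ℝ) / t) volume 0 1)
    (h1 : ∀ j ∈ Finset.range m, IntervalIntegrable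
      (fun t => hurwitzHalf (((j + 1 : ℕ) + t) / (m + 1 : ℕ)) * hurwitzHalf t) volume 0 1) :
    (∫ t in (0)..1, (hurwitzHalf (t / (m + 1 : ℕ)) * hurwitzHalf t - √((m + 1 : ℕ) : ℝ) / t)) +
      ∑ j ∈ Finset.range m,
        ∫ t in (0)..1, hurwitzHalf (((j + 1 : ℕ) + t) / (m + 1 : ℕ)) * hurwitzHalf t =
    √((m + 1 : ℕ) : ℝ) * -Real.log (8 * Real.pi) := by
  rw [← integral_hurwitzHalf_sq_sub, ← intervalIntegral.integral_const_mul,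
    ← integral_finsetSum h1, ← integral_add h0 (by
      have := IntervalIntegrable.sum (Finset.range m) h1
      simpa [Finset.sum_fn] using this)]
  refine integral_congr_ae (Eventually.of_forall fun t ht => ?_)
  rw [uIoc_of_le zero_le_one] at ht
  have h2 := sum_hurwitzHalf_div ht.1 m.succ_pos
  rw [Finset.sum_range_succ', Nat.cast_zero, zero_add] at h2
  rw [← Finset.sum_mul]
  linear_combination hurwitzHalf t * h2

/-- Reciprocity for the Dedekind-type sums. -/
theorem abs_hurwitzHalfSum_sub_le {p h : ℕ} [NeZero p] [NeZero h] (hhp : h ≤ p) :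
    |hurwitzHalfSum p (h : ZMod p) - (√((p : ℝ) / h) * hurwitzHalfSum h (-(p : ZMod h)) +
      p / √h * (Real.log (p / h) + constA) + hurwitzHalf 1 ^ 2 * √p)| ≤ 700 * h := by
  have hh : 0 < h := Nat.pos_of_ne_zero (NeZero.ne h)
  have hp : 0 < p := hh.trans_le hhp
  obtain ⟨m, rfl⟩ : ∃ m, h = m + 1 := ⟨h - 1, by omega⟩
  set X : ℝ := (p : ℝ) / (m + 1 : ℕ) with hX
  have hh1 : (1 : ℝ) ≤ (m + 1 : ℕ) := by exact_mod_cast hh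
  have hh0 : (0 : ℝ) < (m + 1 : ℕ) := by linarith
  have hsh : 0 < √((m + 1 : ℕ) : ℝ) := Real.sqrt_pos.2 hh0
  have hssh : √((m + 1 : ℕ) : ℝ) * √((m + 1 : ℕ) : ℝ) = (m + 1 : ℕ) := Real.mul_self_sqrt hh0.le
  have hX0 : 0 < X := by positivity
  have hS := fun j => isSampling_block hh hhp j
  -- `ρ j` is the offset and `S j` the contribution of the `j`-th block.
  set ρ : ℕ → ℝ := fun j => (((m + 1 : ℕ) : ℝ) - (j * p % (m + 1) : ℕ)) / (m + 1 : ℕ) with hρ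
  set S : ℕ → ℝ := fun j => ∑ n ∈ Finset.range ((j + 1) * p / (m + 1) - j * p / (m + 1)),
    hurwitzHalf ((j + (n + ρ j) / X) / (m + 1 : ℕ)) * hurwitzHalf ((n + ρ j) / X) with hSdef
  have hsumS : hurwitzHalfSum p ((m + 1 : ℕ) : ZMod p) = ∑ j ∈ Finset.range m, S (j + 1) + S 0 := by
    rw [hurwitzHalfSum_eq_sum_blocks hh, ← Finset.sum_range_succ']
    refine Finset.sum_congr rfl fun j hj => Finset.sum_congr rfl fun n hn => ?_
    exact block_term_eq hh hp (Finset.mem_range.1 hj) (Finset.mem_range.1 hn)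
  have hρ0 : ρ 0 = 1 := by
    simp only [hρ, zero_mul, Nat.zero_mod, Nat.cast_zero, sub_zero]
    exact div_self hh0.ne'
  have hdual : hurwitzHalfSum (m + 1) (-(p : ZMod (m + 1))) =
      ∑ j ∈ Finset.range m, hurwitzHalf ((j + 1 : ℕ) / (m + 1 : ℕ)) * hurwitzHalf (ρ (j + 1)) +
        hurwitzHalf 1 ^ 2 := by
    rw [hurwitzHalfSum, ZMod.sum_eq_sum_range, Finset.sum_range_succ']
    congr 1
    · refine Finset.sum_congr rfl fun j hj => ?_
      rw [hurwitzHalfMod_neg_mul hh, hurwitzHalfMod_natCast (by omega)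
        (by have := Finset.mem_range.1 hj; omega)]
    · simp [hurwitzHalfMod, sq]
  set I : ℕ → ℝ := fun j => ∫ t in (0)..1, hurwitzHalf ((j + t) / (m + 1 : ℕ)) * hurwitzHalf t with hI
  set I₀ : ℝ := ∫ t in (0)..1, (hurwitzHalf (t / (m + 1 : ℕ)) * hurwitzHalf t -
    √((m + 1 : ℕ) : ℝ) / t) with hI₀
  have hgen : ∀ j ∈ Finset.range m, |S (j + 1) - X * I (j + 1) -
      √X * hurwitzHalf ((j + 1 : ℕ) / (m + 1 : ℕ)) * hurwitzHalf (ρ (j + 1))| ≤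
        180 * √((m + 1 : ℕ) / (j + 1 : ℕ)) := fun j hj =>
    ((hS (j + 1)).abs_sum_hurwitzHalf_mul_sub_le j.succ_pos
      (by have := Finset.mem_range.1 hj; omega)).2
  have hint : ∀ j ∈ Finset.range m, IntervalIntegrable
      (fun t => hurwitzHalf (((j + 1 : ℕ) + t) / (m + 1 : ℕ)) * hurwitzHalf t) volume 0 1 :=
    fun j hj => ((hS (j + 1)).abs_sum_hurwitzHalf_mul_sub_le j.succ_pos
      (by have := Finset.mem_range.1 hj; omega)).1
  have hS0 := hS 0
  change IsSampling X (ρ 0) _ at hS0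
  rw [hρ0] at hS0
  obtain ⟨hint0, hfirst⟩ := hS0.abs_sum_hurwitzHalf_div_mul_sub_le hh
  have hS0eq : S 0 = ∑ n ∈ Finset.range ((0 + 1) * p / (m + 1) - 0 * p / (m + 1)),
      hurwitzHalf ((n + 1) / X / (m + 1 : ℕ)) * hurwitzHalf ((n + 1) / X) := by
    simp only [hSdef, hρ0, Nat.cast_zero, zero_add]
  rw [← hS0eq] at hfirst
  have hK := integral_block_sum hint0 hint
  have htotal : |∑ j ∈ Finset.range m, (S (j + 1) - X * I (j + 1) -
      √X * hurwitzHalf ((j + 1 : ℕ) / (m + 1 : ℕ)) * hurwitzHalf (ρ (j + 1)))| ≤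
      360 * (m + 1 : ℕ) := by
    refine (Finset.abs_sum_le_sum_abs _ _).trans ((Finset.sum_le_sum hgen).trans ?_)
    have e : ∀ j : ℕ, 180 * √(((m + 1 : ℕ) : ℝ) / (j + 1 : ℕ)) =
        180 * √((m + 1 : ℕ) : ℝ) * (1 / √((j + 1 : ℕ) : ℝ)) := fun j => by
      rw [Real.sqrt_div hh0.le]; ring
    simp only [e]
    rw [← Finset.mul_sum]
    have h1 := sum_one_div_sqrt_succ_le m
    have h2 : √(m : ℝ) ≤ √((m + 1 : ℕ) : ℝ) := Real.sqrt_le_sqrt (by push_cast; linarith)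
    calc 180 * √((m + 1 : ℕ) : ℝ) * ∑ j ∈ Finset.range m, 1 / √((j + 1 : ℕ) : ℝ)
        ≤ 180 * √((m + 1 : ℕ) : ℝ) * (2 * √((m + 1 : ℕ) : ℝ)) := by gcongr; linarith
      _ = 360 * (√((m + 1 : ℕ) : ℝ) * √((m + 1 : ℕ) : ℝ)) := by ring
      _ = 360 * (m + 1 : ℕ) := by rw [hssh]
  have hsle : √((m + 1 : ℕ) : ℝ) ≤ (m + 1 : ℕ) := by
    have := Real.one_le_sqrt.2 hh1; nlinarith
  have hXs : X * √((m + 1 : ℕ) : ℝ) = p / √((m + 1 : ℕ) : ℝ) := by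
    rw [hX, div_mul_eq_mul_div, div_eq_div_iff hh0.ne' hsh.ne', mul_assoc, hssh]
  have hXp : √X * √((m + 1 : ℕ) : ℝ) = √p := by
    rw [← Real.sqrt_mul hX0.le, hX, div_mul_cancel₀ _ hh0.ne']
  simp only [Finset.sum_sub_distrib, mul_assoc, ← Finset.mul_sum] at htotal
  have key : hurwitzHalfSum p ((m + 1 : ℕ) : ZMod p) -
      (√X * hurwitzHalfSum (m + 1) (-(p : ZMod (m + 1))) +
      p / √((m + 1 : ℕ) : ℝ) * (Real.log X + constA) + hurwitzHalf 1 ^ 2 * √p) =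
      (∑ j ∈ Finset.range m, S (j + 1) - X * ∑ j ∈ Finset.range m, I (j + 1) -
        √X * ∑ j ∈ Finset.range m,
          hurwitzHalf ((j + 1 : ℕ) / (m + 1 : ℕ)) * hurwitzHalf (ρ (j + 1))) +
      (S 0 - X * √((m + 1 : ℕ) : ℝ) * (Real.log X + Real.eulerMascheroniConstant) - X * I₀ -
        √X * (√((m + 1 : ℕ) : ℝ) + 1) * hurwitzHalf 1 ^ 2) := by
    rw [hsumS, hdual, constA, ← hXs, ← hXp]
    have hK' : I₀ + ∑ j ∈ Finset.range m, I (j + 1) =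
      √((m + 1 : ℕ) : ℝ) * -Real.log (8 * Real.pi) := hK
    linear_combination X * hK'
  rw [key]
  refine (abs_add_le _ _).trans ?_
  linarith

/-! ### From characters to Dedekind-type sums -/

lemma hurwitzZeta_toAddCircle_one_half {q : ℕ} [NeZero q] (b : ZMod q) :
    HurwitzZeta.hurwitzZeta (ZMod.toAddCircle b) (1 / 2) = (hurwitzHalfMod q b : ℂ) := by
  unfold hurwitzHalfMod
  split_ifs with hb
  · rw [hb, map_zero, HurwitzZeta.hurwitzZeta_zero, riemannZeta_one_half]
  · have hq : (0 : ℝ) < q := by exact_mod_cast Nat.pos_of_ne_zero (NeZero.ne q)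
    have hv : (0 : ℝ) < b.val := by
      exact_mod_cast Nat.pos_of_ne_zero ((ZMod.val_eq_zero b).not.2 hb)
    have hlt : (b.val : ℝ) < q := by exact_mod_cast b.val_lt
    rw [ZMod.toAddCircle_apply, hurwitzZeta_one_half (by positivity) ((div_le_one hq).2 hlt.le)]

lemma LFunction_one_half {q : ℕ} [NeZero q] (χ : DirichletCharacter ℂ q) :
    DirichletCharacter.LFunction χ (1 / 2) =
      ((1 / √q : ℝ) : ℂ) * ∑ b, χ b * (hurwitzHalfMod q b : ℂ) := by
  rw [DirichletCharacter.LFunction, ZMod.LFunction, Complex.cpow_neg]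
  have := cpow_one_half_eq_sqrt (x := q) q.cast_nonneg
  rw [Complex.ofReal_natCast] at this
  rw [this]
  simp only [hurwitzZeta_toAddCircle_one_half]
  push_cast
  rw [one_div]

lemma normSq_LFunction_one_half {q : ℕ} [Fact q.Prime] (χ : DirichletCharacter ℂ q) :
    ((‖DirichletCharacter.LFunction χ (1 / 2)‖ ^ 2 : ℝ) : ℂ) =
      1 / q * ∑ b, ∑ c, (hurwitzHalfMod q b * hurwitzHalfMod q c : ℂ) * (χ c⁻¹ * χ b) := by
  have hq : √(q : ℝ) * √q = q := Real.mul_self_sqrt q.cast_nonneg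
  have hconj : ∀ c, (starRingEnd ℂ) (χ c) = χ c⁻¹ := fun c => by
    rw [starRingEnd_apply, MulChar.star_apply', MulChar.inv_apply']
  push_cast
  rw [← Complex.mul_conj', LFunction_one_half]
  simp only [map_mul, map_sum, Complex.conj_ofReal, hconj]
  rw [mul_mul_mul_comm, ← Complex.ofReal_mul, one_div_mul_one_div, hq, Finset.sum_mul_sum]
  push_cast
  congr 1
  exact Finset.sum_congr rfl fun b _ => Finset.sum_congr rfl fun c _ => by ring

/-- Orthogonality of characters turns the second moment over all characters, twisted by `χ(a)`, into
a Dedekind-type sum; the term `b = 0` has to be removed. -/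
lemma sum_normSq_LFunction_mul {q : ℕ} [Fact q.Prime] {a : ZMod q} (ha : a ≠ 0) :
    ∑ χ : DirichletCharacter ℂ q,
        ((‖DirichletCharacter.LFunction χ (1 / 2)‖ ^ 2 : ℝ) : ℂ) * χ a =
      (((q - 1) / q * (hurwitzHalfSum q a - hurwitzHalf 1 ^ 2) : ℝ) : ℂ) := by
  have hqp : q.Prime := Fact.out
  have horth : ∀ b c : ZMod q, ∑ χ : DirichletCharacter ℂ q, χ c⁻¹ * χ (a * b) =
      if c = 0 then 0 else if c = a * b then ((q - 1 : ℝ) : ℂ) else 0 := by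
    intro b c
    split_ifs with h1 h2
    · refine Finset.sum_eq_zero fun χ _ => ?_
      rw [h1, inv_zero, MulChar.map_zero, zero_mul]
    · rw [DirichletCharacter.sum_char_inv_mul_char_eq ℂ (isUnit_iff_ne_zero.2 h1), if_pos h2,
        Nat.totient_prime hqp, Nat.cast_sub hqp.one_le]
      push_cast; rfl
    · rw [DirichletCharacter.sum_char_inv_mul_char_eq ℂ (isUnit_iff_ne_zero.2 h1), if_neg h2]
  have h1 : ∑ χ : DirichletCharacter ℂ q,
        ((‖DirichletCharacter.LFunction χ (1 / 2)‖ ^ 2 : ℝ) : ℂ) * χ a =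
      1 / q * ∑ b, ∑ c, (hurwitzHalfMod q b * hurwitzHalfMod q c : ℂ) *
        ∑ χ : DirichletCharacter ℂ q, χ c⁻¹ * χ (a * b) := by
    simp only [normSq_LFunction_one_half, mul_assoc, Finset.sum_mul, ← Finset.mul_sum]
    congr 1
    rw [Finset.sum_comm]
    refine Finset.sum_congr rfl fun b _ => ?_
    rw [← Finset.mul_sum, Finset.sum_comm]
    congr 1
    refine Finset.sum_congr rfl fun c _ => ?_
    rw [← Finset.mul_sum]
    congr 1
    refine Finset.sum_congr rfl fun χ _ => ?_
    rw [map_mul]; ring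
  rw [h1]
  simp only [horth]
  have h2 : ∀ b : ZMod q, ∑ c, (hurwitzHalfMod q b * hurwitzHalfMod q c : ℂ) *
      (if c = 0 then 0 else if c = a * b then ((q - 1 : ℝ) : ℂ) else 0) =
      ((hurwitzHalfMod q b * hurwitzHalfMod q (a * b) * (q - 1) : ℝ) : ℂ) -
        if b = 0 then ((hurwitzHalf 1 ^ 2 * (q - 1) : ℝ) : ℂ) else 0 := by
    intro b
    rw [Finset.sum_eq_single (a * b) (fun c _ hc => by simp [hc]) (by simp)]
    by_cases hb : b = 0
    · simp [hb, hurwitzHalfMod, sq]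
    · rw [if_neg (mul_ne_zero ha hb), if_pos rfl, if_neg hb]; push_cast; ring
  simp only [h2, Finset.sum_sub_distrib, Finset.sum_ite_eq', Finset.mem_univ, if_true]
  rw [← Complex.ofReal_sum, ← Finset.sum_mul, ← Complex.ofReal_sub]
  have e : (1 : ℂ) / q = ((1 / q : ℝ) : ℂ) := by push_cast; rfl
  rw [e, ← Complex.ofReal_mul, hurwitzHalfSum]
  congr 1; ring

lemma sum_hurwitzHalfMod (q : ℕ) [NeZero q] : ∑ b, hurwitzHalfMod q b = √q * hurwitzHalf 1 := by
  have hq := Nat.pos_of_ne_zero (NeZero.ne q)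
  rw [← sum_hurwitzHalf_div one_pos hq, ← Equiv.sum_comp (Equiv.addRight (1 : ZMod q)),
    ZMod.sum_eq_sum_range]
  refine Finset.sum_congr rfl fun i hi => ?_
  have := hurwitzHalfMod_natCast (q := q) (m := i + 1) (by omega)
    (Finset.mem_range.1 hi)
  push_cast at this
  exact this

/-- The trivial character modulo `q` contributes a bounded amount: `L(1/2, χ₀) = ζ(1/2) (1 - 1/√q)`. -/
lemma norm_LFunctionTrivChar_one_half_le (q : ℕ) [Fact q.Prime] :
    ‖DirichletCharacter.LFunction (1 : DirichletCharacter ℂ q) (1 / 2)‖ ≤ 3 := by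
  have hq1 : (1 : ℝ) ≤ q := by exact_mod_cast (Fact.out : q.Prime).one_le
  have hs : 1 ≤ √(q : ℝ) := Real.one_le_sqrt.2 hq1
  have h1 : ∑ b, (1 : DirichletCharacter ℂ q) b * (hurwitzHalfMod q b : ℂ) =
      (((√q - 1) * hurwitzHalf 1 : ℝ) : ℂ) := by
    have h2 : ∀ b : ZMod q, (1 : DirichletCharacter ℂ q) b * (hurwitzHalfMod q b : ℂ) =
        (hurwitzHalfMod q b : ℂ) - if b = 0 then (hurwitzHalf 1 : ℂ) else 0 := by
      intro b
      by_cases hb : b = 0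
      · rw [hb, MulChar.map_zero, if_pos rfl, hurwitzHalfMod, if_pos rfl]; ring
      · rw [MulChar.one_apply (isUnit_iff_ne_zero.2 hb), if_neg hb]; ring
    simp only [h2, Finset.sum_sub_distrib, Finset.sum_ite_eq', Finset.mem_univ, if_true]
    rw [← Complex.ofReal_sum, sum_hurwitzHalfMod]; push_cast; ring
  rw [LFunction_one_half, h1, ← Complex.ofReal_mul, Complex.norm_real, Real.norm_eq_abs, ← mul_assoc,
    abs_mul]
  have h3 : |1 / √(q : ℝ) * (√q - 1)| ≤ 1 := by
    rw [abs_of_nonneg (mul_nonneg (by positivity) (by linarith)), one_div_mul_eq_div,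
      div_le_one (by linarith)]
    linarith
  have h4 := abs_hurwitzHalf_le_three (x := 1) le_rfl (by norm_num)
  calc _ ≤ 1 * (3 : ℝ) := mul_le_mul h3 h4 (abs_nonneg _) zero_le_one
    _ = 3 := one_mul 3

lemma isPrimitive_iff_ne_one {q : ℕ} [Fact q.Prime] (χ : DirichletCharacter ℂ q) :
    χ.IsPrimitive ↔ χ ≠ 1 := by
  have hq : q.Prime := Fact.out
  rw [DirichletCharacter.isPrimitive_def, ne_eq, DirichletCharacter.eq_one_iff_conductor_eq_one]
  rcases (Nat.dvd_prime hq).1 χ.conductor_dvd_level with h | h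
  · rw [h]; simp [hq.one_lt.ne]
  · rw [h]; simp [hq.one_lt.ne']

/-- The trivial bound, by `x y ≤ (x² + y²) / 2` and the invariance of the sum under `b ↦ a b`. -/
lemma abs_hurwitzHalfSum_le {q : ℕ} [Fact q.Prime] {a : ZMod q} (ha : a ≠ 0) :
    |hurwitzHalfSum q a| ≤ 4 * q * (1 + Real.log q) := by
  have hq : 0 < q := (Fact.out : q.Prime).pos
  have hq0 : (0 : ℝ) < q := by exact_mod_cast hq
  have hperm : ∑ b : ZMod q, hurwitzHalfMod q (a * b) ^ 2 = ∑ b : ZMod q, hurwitzHalfMod q b ^ 2 :=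
    (Equiv.sum_comp (Equiv.mulLeft₀ a ha) fun b => hurwitzHalfMod q b ^ 2)
  have h1 : |hurwitzHalfSum q a| ≤ ∑ b : ZMod q, hurwitzHalfMod q b ^ 2 := by
    refine (Finset.abs_sum_le_sum_abs _ _).trans ?_
    calc _ ≤ ∑ b : ZMod q, (hurwitzHalfMod q b ^ 2 + hurwitzHalfMod q (a * b) ^ 2) / 2 := by
          refine Finset.sum_le_sum fun b _ => ?_
          rw [abs_le]
          constructor
          · nlinarith [sq_nonneg (hurwitzHalfMod q b + hurwitzHalfMod q (a * b))]
          · nlinarith [sq_nonneg (hurwitzHalfMod q b - hurwitzHalfMod q (a * b))]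
      _ = _ := by rw [← Finset.sum_div, Finset.sum_add_distrib, hperm]; ring
  refine h1.trans ?_
  rw [← Equiv.sum_comp (Equiv.addRight (1 : ZMod q)), ZMod.sum_eq_sum_range]
  have h2 : ∀ i ∈ Finset.range q, hurwitzHalfMod q (Equiv.addRight (1 : ZMod q) i) ^ 2 ≤
      4 * q * ((i : ℝ) + 1)⁻¹ := by
    intro i hi
    have hi' := Finset.mem_range.1 hi
    have := hurwitzHalfMod_natCast (q := q) (m := i + 1) (by omega) hi'
    push_cast at this
    rw [Equiv.coe_addRight, this, ← sq_abs]
    have hpos : (0 : ℝ) < (i + 1) / q := by positivity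
    have hle : ((i : ℝ) + 1) / q ≤ 1 := by rw [div_le_one hq0]; exact_mod_cast hi'
    calc _ ≤ (2 / √(((i : ℝ) + 1) / q)) ^ 2 := by gcongr; exact abs_hurwitzHalf_le hpos hle
      _ = _ := by rw [div_pow, Real.sq_sqrt hpos.le]; field_simp; norm_num
  refine (Finset.sum_le_sum h2).trans ?_
  rw [← Finset.mul_sum]
  have h3 := harmonic_le_one_add_log q
  rw [harmonic] at h3
  push_cast at h3
  gcongr

lemma norm_twistedMoment_sub_le {q : ℕ} [Fact q.Prime] {a : ℤ} (ha : (a : ZMod q) ≠ 0) :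
    ‖twistedMoment q a - (hurwitzHalfSum q (a : ZMod q) : ℂ)‖ ≤ 22 + 4 * Real.log q := by
  classical
  have hq1 : (1 : ℝ) ≤ q := by exact_mod_cast (Fact.out : q.Prime).one_le
  have hq0 : (0 : ℝ) < q := by linarith
  set L : ℝ := ‖DirichletCharacter.LFunction (1 : DirichletCharacter ℂ q) (1 / 2)‖ with hL
  set W : ℝ := hurwitzHalfSum q (a : ZMod q) with hW
  have h1 : twistedMoment q a =
      (((q - 1) / q * (W - hurwitzHalf 1 ^ 2) - L ^ 2 : ℝ) : ℂ) := by
    rw [Complex.ofReal_sub, hW, ← sum_normSq_LFunction_mul ha, twistedMoment,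
      ← Finset.add_sum_erase Finset.univ _ (Finset.mem_univ 1),
      MulChar.one_apply (isUnit_iff_ne_zero.2 ha), mul_one, add_sub_cancel_left]
    refine Finset.sum_congr ?_ fun _ _ => rfl
    ext χ
    simp [isPrimitive_iff_ne_one]
  rw [h1, ← Complex.ofReal_sub, Complex.norm_real, Real.norm_eq_abs]
  have hL3 : L ≤ 3 := norm_LFunctionTrivChar_one_half_le q
  have hL0 : 0 ≤ L := norm_nonneg _
  have hL2 : L ^ 2 ≤ 9 := by nlinarith
  have hF : hurwitzHalf 1 ^ 2 ≤ 9 := by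
    have := abs_le.1 (abs_hurwitzHalf_le_three (x := 1) le_rfl (by norm_num)); nlinarith
  have hWb : |W / q| ≤ 4 * (1 + Real.log q) := by
    rw [abs_div, abs_of_pos hq0, div_le_iff₀ hq0]
    have := abs_hurwitzHalfSum_le ha
    linarith
  have hr0 : 0 ≤ ((q : ℝ) - 1) / q := div_nonneg (by linarith) hq0.le
  have hr1 : ((q : ℝ) - 1) / q ≤ 1 := by rw [div_le_one hq0]; linarith
  have e : ((q : ℝ) - 1) / q * (W - hurwitzHalf 1 ^ 2) - L ^ 2 - W =
      -(W / q) - (((q : ℝ) - 1) / q * hurwitzHalf 1 ^ 2 + L ^ 2) := by field_simp; ring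
  have h5 : ((q : ℝ) - 1) / q * hurwitzHalf 1 ^ 2 ≤ 9 := by nlinarith [sq_nonneg (hurwitzHalf 1)]
  have h6 : 0 ≤ ((q : ℝ) - 1) / q * hurwitzHalf 1 ^ 2 := by positivity
  rw [e]
  rw [abs_le] at hWb ⊢
  constructor <;> nlinarith

end

theorem theorem10 :
    ∃ C : ℝ, ∀ (p h : ℕ) [Fact p.Prime] [Fact h.Prime], h < p →
      ‖twistedMoment p (h : ℤ) -
          ((Real.sqrt ((p : ℝ) / h) : ℂ) * twistedMoment h (-(p : ℤ)) +
            (((p : ℝ) / Real.sqrt h * (Real.log ((p : ℝ) / h) + constA) : ℝ) : ℂ) +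
            constB / 2 * (Real.sqrt p : ℂ))‖ ≤
        C * ((h : ℝ) + Real.log p + Real.sqrt ((p : ℝ) / h) * Real.log p) := by
  refine ⟨700, fun p h _ _ hlt => ?_⟩
  have hp : p.Prime := Fact.out
  have hh : h.Prime := Fact.out
  have hh0 : (0 : ℝ) < h := by exact_mod_cast hh.pos
  have hp3 : (3 : ℝ) ≤ p := by exact_mod_cast (by have := hh.two_le; omega : 3 ≤ p)
  have hhp : (h : ℝ) ≤ p := by exact_mod_cast hlt.le
  have hlog1 : 1 ≤ Real.log p := by
    rw [Real.le_log_iff_exp_le (by linarith)]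
    linarith [Real.exp_one_lt_d9]
  have hlogh : Real.log h ≤ Real.log p := Real.log_le_log hh0 hhp
  have ha1 : (((h : ℤ)) : ZMod p) ≠ 0 := by
    rw [Int.cast_natCast, ne_eq, ZMod.natCast_eq_zero_iff]
    exact fun hd => absurd (Nat.le_of_dvd hh.pos hd) (by omega)
  have ha2 : ((-(p : ℤ) : ℤ) : ZMod h) ≠ 0 := by
    rw [Int.cast_neg, Int.cast_natCast, neg_ne_zero, ne_eq, ZMod.natCast_eq_zero_iff]
    exact fun hd => absurd ((Nat.prime_dvd_prime_iff_eq hh hp).1 hd) (by omega)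
  have h1 := norm_twistedMoment_sub_le ha1
  have h2 := norm_twistedMoment_sub_le ha2
  have h3 := abs_hurwitzHalfSum_sub_le (p := p) (h := h) hlt.le
  rw [Int.cast_natCast] at h1
  rw [Int.cast_neg, Int.cast_natCast] at h2
  have hB : constB / 2 = ((hurwitzHalf 1 ^ 2 : ℝ) : ℂ) := by
    rw [constB, riemannZeta_one_half]; push_cast; ring
  rw [hB]
  set W₁ := hurwitzHalfSum p (h : ZMod p)
  set W₂ := hurwitzHalfSum h (-(p : ZMod h))
  set s := √((p : ℝ) / h)
  set M := (p : ℝ) / √h * (Real.log ((p : ℝ) / h) + constA)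
  have e : twistedMoment p (h : ℤ) - ((s : ℂ) * twistedMoment h (-(p : ℤ)) + (M : ℂ) +
      ((hurwitzHalf 1 ^ 2 : ℝ) : ℂ) * (√p : ℂ)) =
      (twistedMoment p (h : ℤ) - (W₁ : ℂ)) - (s : ℂ) * (twistedMoment h (-(p : ℤ)) - (W₂ : ℂ)) +
        ((W₁ - (s * W₂ + M + hurwitzHalf 1 ^ 2 * √p) : ℝ) : ℂ) := by
    push_cast; ring
  have hs0 : 0 ≤ s := Real.sqrt_nonneg _
  have h4 : ‖(s : ℂ) * (twistedMoment h (-(p : ℤ)) - (W₂ : ℂ))‖ ≤ s * (26 * Real.log p) := by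
    rw [norm_mul, Complex.norm_real, Real.norm_eq_abs, abs_of_nonneg hs0]
    gcongr
    linarith
  have h5 : ‖((W₁ - (s * W₂ + M + hurwitzHalf 1 ^ 2 * √p) : ℝ) : ℂ)‖ ≤ 700 * h := by
    rw [Complex.norm_real]; exact h3
  rw [e]
  refine (norm_add_le _ _).trans ((add_le_add_left (norm_sub_le _ _) _).trans ?_)
  have h6 : 0 ≤ s * Real.log p := mul_nonneg hs0 (by linarith)
  linarith
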